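/- **Setup.** Let $\mathfrak m\subset\mathfrak t^d=\mathbb R^d$ be a linear subspace spanned by integer vectors, $M=\exp\mathfrak m\subset T^d$ the corresponding subtorus, $N=T^d/M$, $\mathfrak n=\mathbb R^d/\mathfrak m$, $n=\dim\mathfrak n$, and let $u_i\in\mathfrak n$ be the image of the standard basis vector $e_i$. Let $\iota^*e_i^*\in\mathfrak m^*$ be the restriction of the $i$-th coordinate. For $\alpha\in\mathfrak m^*$ and $\beta\in\mathfrak m^*_{\mathbb C}$ let $Y(\alpha,\beta)=\mu^{-1}(\alpha,\beta)/M$ be the hyperkähler quotient of $\mathbb H^d=\mathbb C^d\times\mathbb C^d$ by the action $(z,w)\zeta=(z\zeta,w\zeta^{-1})$ of $M$, where $\mu_{\mathbb R}(z,w)=\frac12\sum_i(|z_i|^2-|w_i|^2)\iota^*e_i^*$ and $\mu_{\mathbb C}(z,w)=\sum_i z_iw_i\,\iota^*e_i^*$. Put $$\mathfrak N_\alpha=\{x\in\mathbb R^d:\textstyle\sum_i x_i\iota^*e_i^*=\alpha\},\qquad \mathfrak N_\beta=\{y\in\mathbb C^d:\textstyle\sum_i y_i\iota^*e_i^*=\beta\},$$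 $H_i=\mathfrak N_\alpha\cap\{x_i=0\}$ and $W_i=\mathfrak N_\beta\cap\{y_i=0\}$ (the walls). Let $\bar\mu_{\mathbb R}:Y(\alpha,\beta)\to\mathfrak N_\alpha$, $[z,w]\mapsto(\frac12(|z_i|^2-|w_i|^2))_i$, and $\bar\mu_{\mathbb C}:Y(\alpha,\beta)\to\mathfrak N_\beta$, $[z,w]\mapsto(z_iw_i)_i$, be the residual moment maps of the action of $N$. For $b\in\mathfrak N_\beta$ put $F_b=\bar\mu_{\mathbb C}^{-1}(b)$, and for $x\in\mathfrak N_\alpha$ put $L_b(x)=\{l: b\in W_l,\ x\in H_l\}$. **Theorem.** Let $b\in\mathfrak N_\beta$. 1. $\mathfrak N_\alpha$ is a translate $x_0+\mathfrak n^*$, where $\xi\in\mathfrak n^*$ is identified with $(\langle\xi,u_i\rangle)_i\in\mathbb R^d$, and $H_l=\{x_0+\xi:\langle\xi,u_l\rangle=-(x_0)_l\}$. There are an affine isomorphism $\mathbb R^n\cong\mathfrak N_\alpha$ and an isomorphism of topological groups $T^n\cong N$ such that the resulting map $(\mathbb C^*)^n\cong\mathbb R^n\times T^n\to\mathfrak N_\alpha\times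 N$, where $(\mathbb C^*)^n\cong\mathbb R^n\times T^n$ is given by $c_j=e^{r_j}t_j$, is a diffeomorphism. 2. Let $C_b$ be the topological quotient of $\mathfrak N_\alpha\times N\cong(\mathbb C^*)^n$ by the equivalence relation generated by $(x,g)\sim(x,g\exp(su_l))$ for all $l$ with $b\in W_l$, all $x\in H_l$, $g\in N$ and $s\in\mathbb R$; that is, for each wall $W_l$ through $b$ the circle generated by $u_l$ is collapsed over $H_l$. There is an $N$-equivariant homeomorphism $\Phi:C_b\to F_b$ with $\bar\mu_{\mathbb R}(\Phi[x,g])=x$. For every set $J$ of indices it restricts to a diffeomorphism between the parts of $C_b$ and of $F_b$ over $\{x\in\mathfrak N_\alpha: L_b(x)=J\}$; here a function on one of these parts is called smooth if its pullback to $\mathfrak N_\alpha\times T^d\subset\mathbb R^d\times\mathbb C^d$, respectively to $\mu^{-1}(\alpha,\beta)\subset\mathbb C^d\times\mathbb C^d$, is locally the restriction of a smooth function of the ambient space. 3. If $b$ lies on $W_i$ and on no other wall $W_j$, then $(x,g)$ and $(x',g')$ have the same image in $C_b$ if and only if $x=x'$ and either $g=g'$, or $x\in H_i$ and $g^{-1}g'\in\exp(\mathbb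 Ru_i)$. If $u_i\neq0$, then $\exp(\mathbb Ru_i)$ is a circle. 4. In general $(x,g)$ and $(x',g')$ have the same image in $C_b$ if and only if $x=x'$ and $g^{-1}g'\in\exp(\operatorname{span}\{u_l:l\in L_b(x)\})$. For every set $J$ of indices, $\exp(\operatorname{span}\{u_l:l\in J\})$ is the subgroup of $N$ generated by the circles $\exp(\mathbb Ru_l)$, $l\in J$, and it is isomorphic, as a topological group, to a torus of dimension $\dim\operatorname{span}\{u_l:l\in J\}$. -/

import Mathlib

open scoped ContDiff

noncomputable section

namespace ToricHK

variable {d : ℕ}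

/-! ### Tori -/

/-- The exponential map `𝔱^d → T^d` of the real torus, `t ↦ (exp (√-1 t_i))_i`. -/
def expT (t : Fin d → ℝ) : Fin d → Circle := fun i => Circle.exp (t i)

theorem expT_zero : expT (0 : Fin d → ℝ) = 1 := by
  funext i; simp [expT]

theorem expT_add (s t : Fin d → ℝ) : expT (s + t) = expT s * expT t := by
  funext i; simp [expT, Circle.exp_add]

theorem expT_neg (t : Fin d → ℝ) : expT (-t) = (expT t)⁻¹ := by
  funext i; simp [expT, Circle.exp_neg]

/-- `𝔪` is spanned by integer vectors. -/
def IsRational (𝔪 : Submodule ℝ (Fin d → ℝ)) : Prop :=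
  ∃ S : Set (Fin d → ℤ), 𝔪 = Submodule.span ℝ ((fun v i => (v i : ℝ)) '' S)

/-- The connected subgroup `M = exp 𝔪` of `T^d`; a subtorus if `𝔪` is rational. -/
def subtorus (𝔪 : Submodule ℝ (Fin d → ℝ)) : Subgroup (Fin d → Circle) where
  carrier := expT '' (𝔪 : Set (Fin d → ℝ))
  one_mem' := ⟨0, 𝔪.zero_mem, expT_zero⟩
  mul_mem' := by
    rintro _ _ ⟨s, hs, rfl⟩ ⟨t, ht, rfl⟩
    exact ⟨s + t, 𝔪.add_mem hs ht, expT_add s t⟩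
  inv_mem' := by
    rintro _ ⟨s, hs, rfl⟩
    exact ⟨-s, 𝔪.neg_mem hs, expT_neg s⟩

/-- The quotient torus `N = T^d / M`. -/
abbrev NTorus (𝔪 : Submodule ℝ (Fin d → ℝ)) : Type := (Fin d → Circle) ⧸ subtorus 𝔪

/-- Its Lie algebra `𝔫 = 𝔱^d / 𝔪`. -/
abbrev NLie (𝔪 : Submodule ℝ (Fin d → ℝ)) : Type := (Fin d → ℝ) ⧸ 𝔪

/-- The vector `u_i = π(e_i) ∈ 𝔫`. -/
def u (𝔪 : Submodule ℝ (Fin d → ℝ)) (i : Fin d) : NLie 𝔪 := 𝔪.mkQ (Pi.single i 1)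

/-- The exponential map `𝔫 → N`, induced by `exp : 𝔱^d → T^d`. -/
def expN (𝔪 : Submodule ℝ (Fin d → ℝ)) : NLie 𝔪 → NTorus 𝔪 :=
  Quotient.lift (fun t => (QuotientGroup.mk (expT t) : NTorus 𝔪)) (by
    intro s t h
    have h' : s - t ∈ 𝔪 := (Submodule.quotientRel_def 𝔪).1 h
    refine QuotientGroup.eq.2 ⟨t - s, ?_, ?_⟩
    · simpa using 𝔪.neg_mem h'
    · rw [sub_eq_add_neg, expT_add, expT_neg, mul_comm])

theorem expN_mkQ (𝔪 : Submodule ℝ (Fin d → ℝ)) (t : Fin d → ℝ) :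
    expN 𝔪 (𝔪.mkQ t) = QuotientGroup.mk (expT t) := rfl

theorem expN_zero (𝔪 : Submodule ℝ (Fin d → ℝ)) : expN 𝔪 0 = 1 := by
  rw [← map_zero 𝔪.mkQ, expN_mkQ, expT_zero]; rfl

theorem expN_add (𝔪 : Submodule ℝ (Fin d → ℝ)) (v w : NLie 𝔪) :
    expN 𝔪 (v + w) = expN 𝔪 v * expN 𝔪 w := by
  obtain ⟨s, rfl⟩ := 𝔪.mkQ_surjective v
  obtain ⟨t, rfl⟩ := 𝔪.mkQ_surjective w
  rw [← map_add, expN_mkQ, expN_mkQ, expN_mkQ, expT_add]; rfl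

/-- The subgroup `exp V ⊆ N` of a linear subspace `V ⊆ 𝔫`. -/
def expSubgroup (𝔪 : Submodule ℝ (Fin d → ℝ)) (V : Submodule ℝ (NLie 𝔪)) :
    Subgroup (NTorus 𝔪) where
  carrier := expN 𝔪 '' (V : Set (NLie 𝔪))
  one_mem' := ⟨0, V.zero_mem, expN_zero 𝔪⟩
  mul_mem' := by
    rintro _ _ ⟨s, hs, rfl⟩ ⟨t, ht, rfl⟩
    exact ⟨s + t, V.add_mem hs ht, expN_add 𝔪 s t⟩
  inv_mem' := by
    rintro _ ⟨s, hs, rfl⟩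
    refine ⟨-s, V.neg_mem hs, eq_inv_of_mul_eq_one_left ?_⟩
    rw [← expN_add, neg_add_cancel, expN_zero]

/-- The circle of `N` generated by `u_l`, that is, `{exp (s u_l) | s ∈ ℝ}`. -/
def circleOf (𝔪 : Submodule ℝ (Fin d → ℝ)) (l : Fin d) : Subgroup (NTorus 𝔪) :=
  expSubgroup 𝔪 (Submodule.span ℝ {u 𝔪 l})

/-- The subgroup of `N` generated by the `u_l`, `l ∈ J`: the exponential of their linear span. -/
def torusOf (𝔪 : Submodule ℝ (Fin d → ℝ)) (J : Set (Fin d)) : Subgroup (NTorus 𝔪) :=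
  expSubgroup 𝔪 (Submodule.span ℝ (u 𝔪 '' J))

/-! ### Moment maps and the hyperkähler quotient -/

/-- Flat quaternionic space `ℍ^d = ℂ^d × ℂ^d`, with points `(z, w)`. -/
abbrev HSpace (d : ℕ) : Type := (Fin d → ℂ) × (Fin d → ℂ)

/-- The action `(z, w) ζ = (z ζ, w ζ⁻¹)` of `T^d` on `ℍ^d`. -/
def act (ζ : Fin d → Circle) (p : HSpace d) : HSpace d :=
  (fun i => p.1 i * (ζ i : ℂ), fun i => p.2 i * ((ζ i)⁻¹ : Circle))

theorem act_one (p : HSpace d) : act 1 p = p := by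
  simp [act]

theorem act_mul (ζ η : Fin d → Circle) (p : HSpace d) : act (ζ * η) p = act ζ (act η p) := by
  ext i <;> simp [act] <;> ring

/-- `½(|z_i|² - |w_i|²)`, for all `i`. -/
def realCoord (p : HSpace d) : Fin d → ℝ := fun i => (1 / 2) * (‖p.1 i‖ ^ 2 - ‖p.2 i‖ ^ 2)

/-- `z_i w_i`, for all `i`. -/
def complexCoord (p : HSpace d) : Fin d → ℂ := fun i => p.1 i * p.2 i

theorem realCoord_act (ζ : Fin d → Circle) (p : HSpace d) :
    realCoord (act ζ p) = realCoord p := by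
  funext i
  simp only [realCoord, act, norm_mul, Circle.norm_coe, mul_one]

theorem complexCoord_act (ζ : Fin d → Circle) (p : HSpace d) :
    complexCoord (act ζ p) = complexCoord p := by
  funext i
  have h : (ζ i : ℂ) ≠ 0 := Circle.coe_ne_zero _
  simp only [complexCoord, act, Circle.coe_inv]
  field_simp

/-- `ι^* e_i^* ∈ 𝔪^*`. -/
def coordM (𝔪 : Submodule ℝ (Fin d → ℝ)) (i : Fin d) : 𝔪 →ₗ[ℝ] ℝ :=
  (LinearMap.proj i : (Fin d → ℝ) →ₗ[ℝ] ℝ) ∘ₗ 𝔪.subtype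

/-- `ι^* e_i^*` as an element of `𝔪^*_ℂ`, the space of real-linear maps `𝔪 → ℂ`. -/
def coordMC (𝔪 : Submodule ℝ (Fin d → ℝ)) (i : Fin d) : 𝔪 →ₗ[ℝ] ℂ :=
  Complex.ofRealCLM.toLinearMap ∘ₗ coordM 𝔪 i

/-- The real moment map `μ_ℝ : ℍ^d → 𝔪^*` of `M`. -/
def muR (𝔪 : Submodule ℝ (Fin d → ℝ)) (p : HSpace d) : 𝔪 →ₗ[ℝ] ℝ :=
  (1 / 2 : ℝ) • ∑ i, (‖p.1 i‖ ^ 2 - ‖p.2 i‖ ^ 2) • coordM 𝔪 i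

/-- The complex moment map `μ_ℂ : ℍ^d → 𝔪^*_ℂ` of `M`. -/
def muC (𝔪 : Submodule ℝ (Fin d → ℝ)) (p : HSpace d) : 𝔪 →ₗ[ℝ] ℂ :=
  ∑ i, (p.1 i * p.2 i) • coordMC 𝔪 i

/-- The solution space `𝔑_α = {x ∈ ℝ^d | ∑ x_i ι^* e_i^* = α}`, a copy of `𝔫^*`. -/
def NR {𝔪 : Submodule ℝ (Fin d → ℝ)} (α : 𝔪 →ₗ[ℝ] ℝ) : Set (Fin d → ℝ) :=
  {x | ∑ i, x i • coordM 𝔪 i = α}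

/-- The solution space `𝔑_β = {y ∈ ℂ^d | ∑ y_i ι^* e_i^* = β}`, a copy of `𝔫^*_ℂ`. -/
def NC {𝔪 : Submodule ℝ (Fin d → ℝ)} (β : 𝔪 →ₗ[ℝ] ℂ) : Set (Fin d → ℂ) :=
  {y | ∑ i, y i • coordMC 𝔪 i = β}

/-- The real hyperplane `H_i = 𝔑_α ∩ {x_i = 0}`. -/
def H {𝔪 : Submodule ℝ (Fin d → ℝ)} (α : 𝔪 →ₗ[ℝ] ℝ) (i : Fin d) : Set (NR α) :=
  {x | x.1 i = 0}

/-- The wall `W_i = 𝔑_β ∩ {y_i = 0}`. -/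
def W {𝔪 : Submodule ℝ (Fin d → ℝ)} (β : 𝔪 →ₗ[ℝ] ℂ) (i : Fin d) : Set (NC β) :=
  {y | y.1 i = 0}

variable {𝔪 : Submodule ℝ (Fin d → ℝ)} (α : 𝔪 →ₗ[ℝ] ℝ) (β : 𝔪 →ₗ[ℝ] ℂ)

/-- The level set `μ⁻¹(α, β)`. -/
def levelSet : Set (HSpace d) := {p | muR 𝔪 p = α ∧ muC 𝔪 p = β}

theorem muR_eq (p : HSpace d) : muR 𝔪 p = ∑ i, realCoord p i • coordM 𝔪 i := by
  simp [muR, realCoord, Finset.smul_sum, smul_smul]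

theorem muC_eq (p : HSpace d) : muC 𝔪 p = ∑ i, complexCoord p i • coordMC 𝔪 i := rfl

theorem act_mem {p : HSpace d} (hp : p ∈ levelSet α β) (ζ : Fin d → Circle) :
    act ζ p ∈ levelSet α β := by
  obtain ⟨h1, h2⟩ := hp
  refine ⟨?_, ?_⟩
  · rw [muR_eq, realCoord_act, ← muR_eq, h1]
  · rw [muC_eq, complexCoord_act, ← muC_eq, h2]

/-- Two points of the level set are identified if they lie in one `M`-orbit. -/
def orbitSetoid : Setoid (levelSet α β) where
  r p q := ∃ ζ ∈ subtorus 𝔪, act ζ p.1 = q.1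
  iseqv :=
    { refl := fun p => ⟨1, one_mem _, act_one _⟩
      symm := by
        rintro p q ⟨ζ, hζ, h⟩
        exact ⟨ζ⁻¹, inv_mem hζ, by rw [← h, ← act_mul, inv_mul_cancel, act_one]⟩
      trans := by
        rintro p q r ⟨ζ, hζ, h⟩ ⟨η, hη, h'⟩
        exact ⟨η * ζ, mul_mem hη hζ, by rw [act_mul, h, h']⟩ }

/-- The toric hyperkähler variety `Y(α, β) = μ⁻¹(α, β) / M`, with the quotient topology. -/
abbrev Y : Type := Quotient (orbitSetoid α β)

/-- The residual action of `N = T^d / M` on `Y(α, β)`, induced by the action of `T^d`. -/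
def actY : NTorus 𝔪 → Y α β → Y α β :=
  Quotient.map₂ (fun (ζ : Fin d → Circle) (p : levelSet α β) =>
      (⟨act ζ p.1, act_mem α β p.2 ζ⟩ : levelSet α β)) (by
    intro ζ ζ' h p p' hp
    obtain ⟨η, hη, hp⟩ := hp
    have hζ : ζ⁻¹ * ζ' ∈ subtorus 𝔪 := QuotientGroup.leftRel_apply.1 h
    refine ⟨(ζ⁻¹ * ζ') * η, mul_mem hζ hη, ?_⟩
    change act _ (act ζ p.1) = act ζ' p'.1
    rw [← hp, ← act_mul, ← act_mul]
    congr 1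
    rw [mul_right_comm, mul_right_comm ζ⁻¹, inv_mul_cancel, one_mul])

/-- The residual real moment map `[z, w] ↦ ½ ∑ (|z_i|² - |w_i|²) e_i^*`, with values in
`𝔑_α ≅ 𝔫^*`. -/
def residualR : Y α β → NR α :=
  Quotient.lift (fun p : levelSet α β => ⟨realCoord p.1, by
      change ∑ i, _ = α
      rw [← muR_eq]; exact p.2.1⟩) (by
    rintro p q ⟨ζ, -, h⟩
    exact Subtype.ext ((realCoord_act ζ p.1).symm.trans (congrArg realCoord h)))

/-- The residual complex moment map `[z, w] ↦ ∑ z_i w_i e_i^*`, with values in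
`𝔑_β ≅ 𝔫^*_ℂ`. -/
def residualC : Y α β → NC β :=
  Quotient.lift (fun p : levelSet α β => ⟨complexCoord p.1, by
      change ∑ i, _ = β
      rw [← muC_eq]; exact p.2.2⟩) (by
    rintro p q ⟨ζ, -, h⟩
    exact Subtype.ext ((complexCoord_act ζ p.1).symm.trans (congrArg complexCoord h)))

variable {β}

/-- The fiber `F_b` of the residual complex moment map, as a subspace of `Y(α, β)`. -/
abbrev Fiber (b : NC β) : Type := {y : Y α β // residualC α β y = b}

/-- The preimage of `F_b` in the level set. -/
abbrev FiberLevel (b : NC β) : Type := {p : levelSet α β // residualC α β (Quotient.mk _ p) = b}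

/-- The projection of the preimage of `F_b` to `F_b`. -/
def fiberMk (b : NC β) (p : FiberLevel α b) : Fiber α b := ⟨Quotient.mk _ p.1, p.2⟩

variable {α}

/-! ### Collapsing -/

/-- The elementary identifications: for every wall `W_l` through `b`, the orbits of the circle
generated by `u_l` are collapsed over the hyperplane `H_l`. -/
def CollapseStep (α : 𝔪 →ₗ[ℝ] ℝ) (b : NC β) (p q : NR α × NTorus 𝔪) : Prop :=
  ∃ l, b ∈ W β l ∧ p.1 ∈ H α l ∧ q.1 = p.1 ∧ ∃ c ∈ circleOf 𝔪 l, q.2 = p.2 * c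

/-- The space obtained from `𝔑_α × N` by collapsing, for every wall `W_l` through `b`, the circle
generated by `u_l` over `H_l`: the quotient, with the quotient topology, by the equivalence
relation generated by the elementary identifications. -/
abbrev Collapse (α : 𝔪 →ₗ[ℝ] ℝ) (b : NC β) : Type :=
  Quotient (Relation.EqvGen.setoid (CollapseStep α b))

/-- The collapsing map. -/
def collapseMk (b : NC β) (p : NR α × NTorus 𝔪) : Collapse α b := Quotient.mk _ p

/-- The set of all `l` such that `b` lies on the wall `W_l` and `x` lies on the
hyperplane `H_l`. -/
def active (b : NC β) (x : NR α) : Set (Fin d) := {l | b ∈ W β l ∧ x ∈ H α l}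

/-! ### Smooth functions on quotients of subsets of vector spaces -/

/-- Let `P` sit in a normed space `E` through `e`, and let `π : P → X` be a projection. The function
`f` on `X` is smooth along `π` if `f ∘ π` is, near every point of `P`, the restriction of a
smooth function on an open subset of `E`. -/
def SmoothAlong {P E X : Type*} [NormedAddCommGroup E] [NormedSpace ℝ E]
    (e : P → E) (π : P → X) (f : X → ℝ) : Prop :=
  ∀ a : P, ∃ (O : Set E) (F : E → ℝ), IsOpen O ∧ e a ∈ O ∧ ContDiffOn ℝ ∞ F O ∧
    ∀ a' : P, e a' ∈ O → F (e a') = f (π a')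

/-- The torus `T^d` inside `ℂ^d`. -/
def torusCoe (t : Fin d → Circle) : Fin d → ℂ := fun i => (t i : ℂ)

/-- The part of `F_b` over `{x ∈ 𝔑_α | active b x = J}`, seen upstairs in the level set. -/
abbrev FiberStratum (α : 𝔪 →ₗ[ℝ] ℝ) (b : NC β) (J : Set (Fin d)) : Type :=
  {p : FiberLevel α b // active b (residualR α β (fiberMk α b p).1) = J}

/-- The part of `𝔑_α × T^d` over `{x ∈ 𝔑_α | active b x = J}`. -/
abbrev ModelStratum (α : 𝔪 →ₗ[ℝ] ℝ) (b : NC β) (J : Set (Fin d)) : Type :=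
  {q : NR α × (Fin d → Circle) // active b q.1 = J}

end ToricHK

end

open ToricHK

/-!
Everything is explicit once there is a continuous section of the moment maps. For `b ∈ 𝔑_β` and
`x ∈ 𝔑_α`, the point `s(x) = (z, w)` with `z_i ≥ 0`, `½(|z_i|² - |w_i|²) = x_i` and `z_i w_i = b_i`
is given by `|z_i|² = √(x_i² + |b_i|²) + x_i` and `|w_i|² = √(x_i² + |b_i|²) - x_i`, with `w_i` of
the phase of `b_i`, or `w_i ≥ 0` if `b_i = 0` (`sectionPt`). It depends continuously on `x`, and
every point of the level set over `b` and `x` is `ζ · s(x)` for some `ζ ∈ T^d` (`act_phaseVec`). The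
stabilizer of `s(x)` in `T^d` consists of the `ζ` with `ζ_i = 1` unless `b_i = x_i = 0`
(`act_sectionPt_eq_iff`), that is, it is the coordinate subtorus of the active indices; its image in
`N` is the exponential of the span of the `u_l`, `l` active, which is the subgroup generated by their
circles. Hence `(x, ζ) ↦ [ζ · s(x)]` and the collapsing map identify the same points of `𝔑_α × T^d`
(`fiberMk_rotateSection_eq_iff`). Both maps are quotient maps, the first one because
`(x, ζ) ↦ ζ · s(x)` is proper (`isQuotientMap_rotateSection`); this yields the homeomorphism `Φ`.

On the stratum with active set `J`, the coordinates of `s` in `J` vanish identically and the others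
are smooth functions of `x`, since `√(√(x² + |b|²) + x)` is smooth away from `x = b = 0`. Conversely,
the phases which recover `ζ` are, locally, smooth functions of `(z, w)`. Both directions of the
smoothness statement follow by substituting these functions (`SmoothAlong.transfer`).

The assertions on tori come from the lattices: if `V` is rational, then `V ∩ ℤ^d` is a direct
summand of `ℤ^d` (`exists_lattice_splitting`), so that integer matrices give inverse isomorphisms
between `exp V`, respectively `T^d / exp V`, and standard tori (`IntegralSplitting`).
-/

open scoped ContDiff

noncomputable section

namespace ToricHK

open Topology

variable {d : ℕ}

/-! ### Integer matrices and homomorphisms of tori -/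

/-- The homomorphism of tori `T^m → T^k` given by an integer matrix:
`ζ ↦ (∏_j ζ_j ^ (A i j))_i`. -/
def torusMap {k m : ℕ} (A : Matrix (Fin k) (Fin m) ℤ) (ζ : Fin m → Circle) : Fin k → Circle :=
  fun i => ∏ j, ζ j ^ A i j

/-- An integer matrix regarded as a real matrix. -/
abbrev realMat {k m : ℕ} (A : Matrix (Fin k) (Fin m) ℤ) : Matrix (Fin k) (Fin m) ℝ :=
  A.map (Int.cast : ℤ → ℝ)

theorem realMat_mul {k m l : ℕ} (A : Matrix (Fin k) (Fin m) ℤ) (B : Matrix (Fin m) (Fin l) ℤ) :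
    realMat (A * B) = realMat A * realMat B :=
  Matrix.map_mul (f := Int.castRingHom ℝ)

theorem realMat_one {k : ℕ} : realMat (1 : Matrix (Fin k) (Fin k) ℤ) = 1 := by
  simp [realMat]

theorem expT_surjective : Function.Surjective (expT (d := d)) := fun ζ =>
  ⟨fun i => Complex.arg (ζ i), funext fun i => Circle.exp_arg (ζ i)⟩

theorem expT_mulVec {k m : ℕ} (A : Matrix (Fin k) (Fin m) ℤ) (t : Fin m → ℝ) :
    expT ((realMat A).mulVec t) = torusMap A (expT t) := by
  funext i
  simp only [expT, torusMap, Matrix.mulVec, dotProduct, Matrix.map_apply]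
  have h : ∀ f : Fin m → ℝ, Circle.exp (∑ j, f j) = ∏ j, Circle.exp (f j) := fun f =>
    map_sum Circle.expHom f Finset.univ
  rw [h]
  refine Finset.prod_congr rfl fun j _ => ?_
  rw [← zsmul_eq_mul, Circle.exp_zsmul]

theorem torusMap_torusMap {k m l : ℕ} (A : Matrix (Fin k) (Fin m) ℤ)
    (B : Matrix (Fin m) (Fin l) ℤ) (ζ : Fin l → Circle) :
    torusMap A (torusMap B ζ) = torusMap (A * B) ζ := by
  obtain ⟨t, rfl⟩ := expT_surjective ζ
  rw [← expT_mulVec, ← expT_mulVec, ← expT_mulVec, realMat_mul, Matrix.mulVec_mulVec]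

theorem torusMap_one {k : ℕ} (ζ : Fin k → Circle) : torusMap 1 ζ = ζ := by
  obtain ⟨t, rfl⟩ := expT_surjective ζ
  rw [← expT_mulVec, realMat_one, Matrix.one_mulVec]

theorem torusMap_zero {k m : ℕ} (ζ : Fin m → Circle) :
    torusMap (0 : Matrix (Fin k) (Fin m) ℤ) ζ = 1 := by
  funext i
  simp [torusMap]

theorem torusMap_apply_one {k m : ℕ} (A : Matrix (Fin k) (Fin m) ℤ) : torusMap A 1 = 1 := by
  funext i
  simp [torusMap]

theorem torusMap_mul {k m : ℕ} (A : Matrix (Fin k) (Fin m) ℤ) (ζ η : Fin m → Circle) :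
    torusMap A (ζ * η) = torusMap A ζ * torusMap A η := by
  funext i
  simp [torusMap, mul_zpow, Finset.prod_mul_distrib]

theorem torusMap_add {k m : ℕ} (A B : Matrix (Fin k) (Fin m) ℤ) (ζ : Fin m → Circle) :
    torusMap (A + B) ζ = torusMap A ζ * torusMap B ζ := by
  funext i
  simp [torusMap, zpow_add, Finset.prod_mul_distrib]

theorem continuous_torusMap {k m : ℕ} (A : Matrix (Fin k) (Fin m) ℤ) :
    Continuous (torusMap A) := by
  unfold torusMap
  fun_prop

/-! ### The lattice of a rational subspace -/

/-- The inclusion `ℤ^d → ℝ^d`. -/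
abbrev castVec (d : ℕ) : (Fin d → ℤ) →ₗ[ℤ] (Fin d → ℝ) :=
  LinearMap.compLeft (Int.castAddHom ℝ).toIntLinearMap (Fin d)

theorem realMat_mulVec_castVec {k m : ℕ} (A : Matrix (Fin k) (Fin m) ℤ) (v : Fin m → ℤ) :
    (realMat A).mulVec (castVec m v) = castVec k (A.mulVec v) := by
  funext i
  simp [Matrix.mulVec, dotProduct]

/-- The lattice `L = V ∩ ℤ^d` of a rational subspace `V` is a direct summand of `ℤ^d`, since
`ℤ^d / L` is torsion-free and hence free. `P'` and `Q'` are bases of the two summands (as columns),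
`P` and `Q` the coordinates with respect to them. -/
theorem exists_lattice_splitting (V : Submodule ℝ (Fin d → ℝ)) (hV : IsRational V) :
    ∃ (k n : ℕ) (P : Matrix (Fin k) (Fin d) ℤ) (P' : Matrix (Fin d) (Fin k) ℤ)
      (Q : Matrix (Fin n) (Fin d) ℤ) (Q' : Matrix (Fin d) (Fin n) ℤ),
      P' * P + Q' * Q = 1 ∧ P * P' = 1 ∧ Q * Q' = 1 ∧
      ∀ t, t ∈ V ↔ (realMat Q).mulVec t = 0 := by
  let L : Submodule ℤ (Fin d → ℤ) := (V.restrictScalars ℤ).comap (castVec d)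
  have hL : ∀ v, v ∈ L ↔ castVec d v ∈ V := fun v => Iff.rfl
  have : Module.IsTorsionFree ℤ ((Fin d → ℤ) ⧸ L) := by
    refine Module.IsTorsionFree.of_smul_eq_zero fun c x hx => ?_
    obtain ⟨v, rfl⟩ := L.mkQ_surjective x
    rw [← map_smul, Submodule.mkQ_apply, Submodule.Quotient.mk_eq_zero, hL, map_smul] at hx
    refine or_iff_not_imp_left.2 fun hc => (Submodule.Quotient.mk_eq_zero L).2 ?_
    rw [← Int.cast_smul_eq_zsmul ℝ] at hx
    exact (V.smul_mem_iff (Int.cast_ne_zero.2 hc)).1 hx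
  have : Module.Free ℤ ((Fin d → ℤ) ⧸ L) := inferInstance
  obtain ⟨s, hs⟩ := Module.projective_lifting_property L.mkQ LinearMap.id L.mkQ_surjective
  have hs' : ∀ x, L.mkQ (s x) = x := fun x => LinearMap.congr_fun hs x
  let b₁ := (Module.finBasis ℤ L).equivFun
  let b₂ := (Module.finBasis ℤ ((Fin d → ℤ) ⧸ L)).equivFun
  let ρ : (Fin d → ℤ) →ₗ[ℤ] L := (LinearMap.id - s ∘ₗ L.mkQ).codRestrict L (fun v => by
    rw [← Submodule.Quotient.mk_eq_zero]
    have := hs' (L.mkQ v)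
    simp only [Submodule.mkQ_apply] at this
    simp [this])
  have hρ : ∀ v, (ρ v : Fin d → ℤ) = v - s (L.mkQ v) := fun v => rfl
  have hmk : ∀ v : L, L.mkQ v = 0 := fun v => (Submodule.Quotient.mk_eq_zero L).2 v.2
  have hρL : ∀ v : L, ρ v = v := fun v => Subtype.ext (by rw [hρ, hmk]; simp)
  clear_value b₁ b₂ ρ
  have h1 : LinearMap.toMatrix' (L.subtype ∘ₗ b₁.symm.toLinearMap) *
      LinearMap.toMatrix' (b₁.toLinearMap ∘ₗ ρ) +
      LinearMap.toMatrix' (s ∘ₗ b₂.symm.toLinearMap) *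
      LinearMap.toMatrix' (b₂.toLinearMap ∘ₗ L.mkQ) = 1 := by
    rw [← LinearMap.toMatrix'_comp, ← LinearMap.toMatrix'_comp, ← map_add,
      ← LinearMap.toMatrix'_id]
    congr 1
    refine LinearMap.ext fun v => ?_
    simp [hρ, -Submodule.mkQ_apply]
  refine ⟨_, _, _, _, _, _, h1, ?_, ?_, fun t => ⟨fun ht => ?_, fun ht => ?_⟩⟩
  · rw [← LinearMap.toMatrix'_comp, ← LinearMap.toMatrix'_id]
    congr 1
    refine LinearMap.ext fun v => ?_
    simp [hρL]
  · rw [← LinearMap.toMatrix'_comp, ← LinearMap.toMatrix'_id]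
    congr 1
    refine LinearMap.ext fun v => ?_
    simp [hs', -Submodule.mkQ_apply]
  · obtain ⟨S, hS⟩ := hV
    suffices V ≤ LinearMap.ker (realMat (LinearMap.toMatrix' (b₂.toLinearMap ∘ₗ L.mkQ))).mulVecLin
      from this ht
    rw [hS, Submodule.span_le]
    rintro _ ⟨v, hv, rfl⟩
    have hv' : v ∈ L := by
      rw [hL, hS]
      exact Submodule.subset_span ⟨v, hv, rfl⟩
    change (realMat _).mulVec (castVec d v) = 0
    rw [realMat_mulVec_castVec, ← Matrix.toLin'_apply, Matrix.toLin'_toMatrix',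
      LinearMap.comp_apply, hmk ⟨v, hv'⟩, map_zero, map_zero]
  · -- If `Q t = 0`, then `t = P' (P t)` is a combination of the columns of `P'`, which lie in `V`.
    have h2 := congrArg (fun A => (realMat A).mulVec t) h1
    simp only [realMat_one, Matrix.one_mulVec] at h2
    rw [← h2, realMat, Matrix.map_add _ Int.cast_add, Matrix.add_mulVec, ← realMat,
      ← realMat, realMat_mul, realMat_mul, ← Matrix.mulVec_mulVec, ← Matrix.mulVec_mulVec, ht,
      Matrix.mulVec_zero, add_zero, Matrix.mulVec_eq_sum]
    refine Submodule.sum_mem _ fun j _ => ?_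
    rw [op_smul_eq_smul]
    refine V.smul_mem _ ?_
    have := (b₁.symm (Pi.single j 1)).2
    rw [hL] at this
    convert this using 1
    funext i
    simp [LinearMap.toMatrix'_apply]

/-! ### Rational subspaces and their tori -/

/-- A decomposition `ℤ^d = (V ∩ ℤ^d) ⊕ C` of the lattice: `P'` and `Q'` are bases of the two
summands (as columns), `P` and `Q` the coordinates with respect to them. -/
structure IntegralSplitting (V : Submodule ℝ (Fin d → ℝ)) where
  /-- The coordinates along `V`. -/
  P : Matrix (Fin (Module.finrank ℝ V)) (Fin d) ℤ
  /-- The basis of the lattice of `V`. -/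
  P' : Matrix (Fin d) (Fin (Module.finrank ℝ V)) ℤ
  /-- The coordinates along the complement. -/
  Q : Matrix (Fin (Module.finrank ℝ ((Fin d → ℝ) ⧸ V))) (Fin d) ℤ
  /-- The basis of the complement. -/
  Q' : Matrix (Fin d) (Fin (Module.finrank ℝ ((Fin d → ℝ) ⧸ V))) ℤ
  add_eq_one : P' * P + Q' * Q = 1
  P_mul_P' : P * P' = 1
  Q_mul_Q' : Q * Q' = 1
  mem_iff : ∀ t, t ∈ V ↔ (realMat Q).mulVec t = 0

/-- The numbers of columns in `exists_lattice_splitting` are the dimensions of `V` and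
`ℝ^d / V`. -/
theorem exists_integralSplitting {V : Submodule ℝ (Fin d → ℝ)} (hV : IsRational V) :
    Nonempty (IntegralSplitting V) := by
  obtain ⟨k, n, P, P', Q, Q', h1, h2, h3, h4⟩ := exists_lattice_splitting V hV
  have hker : LinearMap.ker (realMat Q).mulVecLin = V := by
    ext t
    simp [h4]
  have hsurj : Function.Surjective (realMat Q).mulVecLin := fun r =>
    ⟨(realMat Q').mulVec r, by
      rw [Matrix.mulVecLin_apply, Matrix.mulVec_mulVec, ← realMat_mul, h3, realMat_one,
        Matrix.one_mulVec]⟩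
  have hn : Module.finrank ℝ ((Fin d → ℝ) ⧸ V) = n := by
    subst hker
    simpa using ((realMat Q).mulVecLin.quotKerEquivOfSurjective hsurj).finrank_eq
  have hQP : Q * P' = 0 := by
    have := congrArg (fun A => Q * A * P') h1
    simp only [Matrix.mul_add, Matrix.add_mul, Matrix.mul_assoc, h2, Matrix.mul_one] at this
    rw [← Matrix.mul_assoc Q Q', h3] at this
    simpa using this
  have hinj : Function.Injective (realMat P').mulVecLin := by
    refine Function.LeftInverse.injective (g := (realMat P).mulVecLin) fun r => ?_
    rw [Matrix.mulVecLin_apply, Matrix.mulVecLin_apply, Matrix.mulVec_mulVec, ← realMat_mul, h2,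
      realMat_one, Matrix.one_mulVec]
  have hrange : LinearMap.range (realMat P').mulVecLin = V := by
    apply le_antisymm
    · rintro _ ⟨r, rfl⟩
      rw [h4, Matrix.mulVecLin_apply, Matrix.mulVec_mulVec, ← realMat_mul, hQP]
      simp [realMat]
    · intro t ht
      refine ⟨(realMat P).mulVec t, ?_⟩
      have h5 := congrArg (fun A => (realMat A).mulVec t) h1
      simp only [realMat_one, Matrix.one_mulVec] at h5
      rw [realMat, Matrix.map_add _ Int.cast_add, Matrix.add_mulVec, ← realMat, ← realMat,
        realMat_mul Q', ← Matrix.mulVec_mulVec, (h4 t).1 ht, Matrix.mulVec_zero, add_zero,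
        realMat_mul, ← Matrix.mulVec_mulVec] at h5
      exact h5
  have hk : Module.finrank ℝ V = k := by
    rw [← hrange, LinearMap.finrank_range_of_inj hinj]
    simp
  subst hn hk
  exact ⟨⟨P, P', Q, Q', h1, h2, h3, h4⟩⟩

namespace IntegralSplitting

variable {V : Submodule ℝ (Fin d → ℝ)} (S : IntegralSplitting V)

theorem Q_mul_P' : S.Q * S.P' = 0 := by
  have := congrArg (fun A => S.Q * A * S.P') S.add_eq_one
  simp only [Matrix.mul_add, Matrix.add_mul, Matrix.mul_assoc, S.P_mul_P', Matrix.mul_one] at this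
  rw [← Matrix.mul_assoc S.Q S.Q', S.Q_mul_Q'] at this
  simpa using this

theorem torusMap_decomp (ζ : Fin d → Circle) :
    torusMap S.P' (torusMap S.P ζ) * torusMap S.Q' (torusMap S.Q ζ) = ζ := by
  rw [torusMap_torusMap, torusMap_torusMap, ← torusMap_add, S.add_eq_one, torusMap_one]

theorem mulVec_decomp (t : Fin d → ℝ) :
    (realMat S.P').mulVec ((realMat S.P).mulVec t) +
      (realMat S.Q').mulVec ((realMat S.Q).mulVec t) = t := by
  have h := congrArg (fun A => (realMat A).mulVec t) S.add_eq_one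
  simp only [realMat_one, Matrix.one_mulVec] at h
  rw [realMat, Matrix.map_add _ Int.cast_add, Matrix.add_mulVec, ← realMat, ← realMat,
    realMat_mul, realMat_mul, ← Matrix.mulVec_mulVec, ← Matrix.mulVec_mulVec] at h
  exact h

theorem P'_mulVec_mem (r : Fin (Module.finrank ℝ V) → ℝ) : (realMat S.P').mulVec r ∈ V := by
  rw [S.mem_iff, Matrix.mulVec_mulVec, ← realMat_mul, S.Q_mul_P']
  simp [realMat]

/-- `exp V` is the kernel of the integral projection along `V`. -/
theorem mem_subtorus_iff (ζ : Fin d → Circle) : ζ ∈ subtorus V ↔ torusMap S.Q ζ = 1 := by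
  constructor
  · rintro ⟨t, ht, rfl⟩
    rw [← expT_mulVec, (S.mem_iff t).1 ht, expT_zero]
  · intro h
    obtain ⟨r, hr⟩ := expT_surjective (torusMap S.P ζ)
    refine ⟨(realMat S.P').mulVec r, S.P'_mulVec_mem r, ?_⟩
    have h1 := S.torusMap_decomp ζ
    rwa [h, torusMap_apply_one, mul_one, ← hr, ← expT_mulVec] at h1

theorem P'_torusMap_mem (ζ : Fin (Module.finrank ℝ V) → Circle) :
    torusMap S.P' ζ ∈ subtorus V := by
  rw [S.mem_subtorus_iff, torusMap_torusMap, S.Q_mul_P', torusMap_zero]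

/-- The subtorus `exp V` is a torus of dimension `dim V`. -/
def subtorusEquiv : subtorus V ≃ₜ* (Fin (Module.finrank ℝ V) → Circle) where
  toFun ζ := torusMap S.P ζ
  invFun η := ⟨torusMap S.P' η, S.P'_torusMap_mem η⟩
  left_inv ζ := by
    apply Subtype.ext
    have h := S.torusMap_decomp ζ
    rw [(S.mem_subtorus_iff ζ).1 ζ.2] at h
    rwa [torusMap_apply_one, mul_one] at h
  right_inv η := by
    change torusMap S.P (torusMap S.P' η) = η
    rw [torusMap_torusMap, S.P_mul_P', torusMap_one]
  map_mul' ζ η := torusMap_mul _ _ _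
  continuous_toFun := (continuous_torusMap _).comp continuous_subtype_val
  continuous_invFun := (continuous_torusMap _).subtype_mk _

/-- The quotient torus `T^d / exp V` is a torus of dimension `dim (ℝ^d / V)`. -/
def quotientEquiv :
    NTorus V ≃ₜ* (Fin (Module.finrank ℝ (NLie V)) → Circle) where
  toFun := Quotient.lift (torusMap S.Q) fun ζ η h => by
    have h' : torusMap S.Q (ζ⁻¹ * η) = 1 :=
      (S.mem_subtorus_iff _).1 (QuotientGroup.leftRel_apply.1 h)
    rw [← mul_one (torusMap S.Q ζ), ← h', ← torusMap_mul, mul_inv_cancel_left]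
  invFun η := QuotientGroup.mk (torusMap S.Q' η)
  left_inv g := by
    obtain ⟨ζ, rfl⟩ := QuotientGroup.mk_surjective g
    refine QuotientGroup.eq.2 ?_
    change (torusMap S.Q' (torusMap S.Q ζ))⁻¹ * ζ ∈ subtorus V
    nth_rw 2 [← S.torusMap_decomp ζ]
    rw [mul_comm, mul_inv_cancel_right]
    exact S.P'_torusMap_mem _
  right_inv η := by
    change torusMap S.Q (torusMap S.Q' η) = η
    rw [torusMap_torusMap, S.Q_mul_Q', torusMap_one]
  map_mul' g h := by
    obtain ⟨ζ, rfl⟩ := QuotientGroup.mk_surjective g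
    obtain ⟨η, rfl⟩ := QuotientGroup.mk_surjective h
    exact torusMap_mul S.Q ζ η
  continuous_toFun := (continuous_torusMap S.Q).quotient_lift _
  continuous_invFun := continuous_quotient_mk'.comp (continuous_torusMap S.Q')

theorem quotientEquiv_mk (ζ : Fin d → Circle) :
    S.quotientEquiv (QuotientGroup.mk ζ) = torusMap S.Q ζ := rfl

/-- The projection along `V` in integral coordinates, as an isomorphism `ℝ^d / V ≅ ℝ^n`. -/
def lieEquiv : NLie V ≃ₗ[ℝ] (Fin (Module.finrank ℝ (NLie V)) → ℝ) :=
  LinearEquiv.ofLinearMap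
    (V.liftQ (realMat S.Q).mulVecLin fun t ht => (S.mem_iff t).1 ht)
    (V.mkQ ∘ₗ (realMat S.Q').mulVecLin)
    (LinearMap.ext fun r => by
      change (realMat S.Q).mulVec ((realMat S.Q').mulVec r) = r
      rw [Matrix.mulVec_mulVec, ← realMat_mul, S.Q_mul_Q', realMat_one, Matrix.one_mulVec])
    (LinearMap.ext fun v => by
      obtain ⟨t, rfl⟩ := V.mkQ_surjective v
      change V.mkQ ((realMat S.Q').mulVec ((realMat S.Q).mulVec t)) = V.mkQ t
      nth_rw 2 [← S.mulVec_decomp t]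
      rw [map_add, Submodule.mkQ_apply V ((realMat S.P').mulVec _),
        (Submodule.Quotient.mk_eq_zero V).2 (S.P'_mulVec_mem _), zero_add])

theorem lieEquiv_mkQ (t : Fin d → ℝ) : S.lieEquiv (V.mkQ t) = (realMat S.Q).mulVec t := rfl

theorem quotientEquiv_expN (v : NLie V) : S.quotientEquiv (expN V v) = expT (S.lieEquiv v) := by
  obtain ⟨t, rfl⟩ := V.mkQ_surjective v
  rw [expN_mkQ, quotientEquiv_mk, lieEquiv_mkQ, expT_mulVec]

end IntegralSplitting

/-! ### Subtori of the quotient torus -/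

variable {𝔪 : Submodule ℝ (Fin d → ℝ)}

/-- In integral coordinates on `𝔫`, the `u_l` are the columns of the integer matrix `Q`. -/
theorem isRational_map_span (S : IntegralSplitting 𝔪) (J : Set (Fin d)) :
    IsRational ((Submodule.span ℝ (u 𝔪 '' J)).map S.lieEquiv.toLinearMap) := by
  refine ⟨(fun l i => S.Q i l) '' J, ?_⟩
  rw [Submodule.map_span, Set.image_image, Set.image_image]
  congr 1
  refine Set.image_congr fun l _ => ?_
  change S.lieEquiv (𝔪.mkQ _) = _
  rw [S.lieEquiv_mkQ]
  funext i
  simp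

theorem mem_expSubgroup_iff (S : IntegralSplitting 𝔪) (V : Submodule ℝ (NLie 𝔪))
    (g : NTorus 𝔪) :
    g ∈ expSubgroup 𝔪 V ↔ S.quotientEquiv g ∈ subtorus (V.map S.lieEquiv.toLinearMap) := by
  constructor
  · rintro ⟨v, hv, rfl⟩
    exact ⟨S.lieEquiv v, ⟨v, hv, rfl⟩, (S.quotientEquiv_expN v).symm⟩
  · rintro ⟨_, ⟨v, hv, rfl⟩, h⟩
    exact ⟨v, hv, S.quotientEquiv.injective ((S.quotientEquiv_expN v).trans h)⟩

theorem torusOf_equiv (h𝔪 : IsRational 𝔪) (J : Set (Fin d)) :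
    Nonempty (torusOf 𝔪 J ≃ₜ*
      (Fin (Module.finrank ℝ (Submodule.span ℝ (u 𝔪 '' J))) → Circle)) := by
  obtain ⟨S⟩ := exists_integralSplitting h𝔪
  obtain ⟨R⟩ := exists_integralSplitting (isRational_map_span S J)
  rw [← LinearEquiv.finrank_map_eq S.lieEquiv]
  have hmem := mem_expSubgroup_iff S (Submodule.span ℝ (u 𝔪 '' J))
  let e : torusOf 𝔪 J ≃ₜ*
      subtorus ((Submodule.span ℝ (u 𝔪 '' J)).map S.lieEquiv.toLinearMap) :=
    { toFun := fun g => ⟨S.quotientEquiv g, (hmem g).1 g.2⟩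
      invFun := fun η => ⟨S.quotientEquiv.symm η, (hmem _).2 (by simp)⟩
      left_inv := fun g => by simp
      right_inv := fun η => by simp
      map_mul' := fun g h => by simp
      continuous_toFun := (S.quotientEquiv.continuous.comp continuous_subtype_val).subtype_mk _
      continuous_invFun :=
        (S.quotientEquiv.symm.continuous.comp continuous_subtype_val).subtype_mk _ }
  exact ⟨e.trans R.subtorusEquiv⟩

theorem circleOf_eq_torusOf (l : Fin d) : circleOf 𝔪 l = torusOf 𝔪 {l} := by
  rw [circleOf, torusOf, Set.image_singleton]

theorem circleOf_equiv (h𝔪 : IsRational 𝔪) (l : Fin d) (hl : u 𝔪 l ≠ 0) :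
    Nonempty (circleOf 𝔪 l ≃ₜ* Circle) := by
  obtain ⟨e⟩ := torusOf_equiv h𝔪 {l}
  rw [Set.image_singleton, finrank_span_singleton hl] at e
  rw [circleOf_eq_torusOf]
  exact ⟨e.trans
    { MulEquiv.funUnique (Fin 1) Circle, Homeomorph.funUnique (Fin 1) Circle with }⟩

theorem expSubgroup_mono {V V' : Submodule ℝ (NLie 𝔪)} (h : V ≤ V') :
    expSubgroup 𝔪 V ≤ expSubgroup 𝔪 V' :=
  Set.image_mono h

theorem torusOf_eq_iSup (J : Set (Fin d)) : torusOf 𝔪 J = ⨆ l ∈ J, circleOf 𝔪 l := by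
  apply le_antisymm
  · rintro _ ⟨v, hv, rfl⟩
    suffices h : ∀ s : ℝ, expN 𝔪 (s • v) ∈ ⨆ l ∈ J, circleOf 𝔪 l by
      simpa using h 1
    refine Submodule.span_induction (p := fun v _ => ∀ s : ℝ, expN 𝔪 (s • v) ∈ _)
      ?_ ?_ ?_ ?_ hv
    · rintro _ ⟨l, hl, rfl⟩ s
      exact (le_iSup₂ (f := fun l (_ : l ∈ J) => circleOf 𝔪 l) l hl)
        ⟨_, Submodule.smul_mem _ s (Submodule.mem_span_singleton_self _), rfl⟩
    · intro s
      rw [smul_zero, expN_zero]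
      exact one_mem _
    · intro v w _ _ hv hw s
      rw [smul_add, expN_add]
      exact mul_mem (hv s) (hw s)
    · intro a v _ hv s
      rw [smul_smul]
      exact hv _
  · exact iSup₂_le fun l hl => expSubgroup_mono
      (Submodule.span_mono (Set.singleton_subset_iff.2 ⟨l, hl, rfl⟩))

/-! ### Smooth functions -/

/-- Smoothness along a projection is inherited by `P'` if, locally, points of `P'` are sent to
points of `P` in the same fiber by a smooth map of the ambient spaces. -/
theorem SmoothAlong.transfer {P E P' E' X : Type*} [NormedAddCommGroup E] [NormedSpace ℝ E]
    [NormedAddCommGroup E'] [NormedSpace ℝ E'] {e : P → E} {π : P → X} {e' : P' → E'}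
    {π' : P' → X} {f : X → ℝ} (hf : SmoothAlong e π f)
    (h : ∀ a : P', ∃ (O : Set E') (G : E' → E), IsOpen O ∧ e' a ∈ O ∧ ContDiffOn ℝ ∞ G O ∧
      ∀ a' : P', e' a' ∈ O → ∃ p : P, e p = G (e' a') ∧ π p = π' a') :
    SmoothAlong e' π' f := by
  intro a
  obtain ⟨O, G, hO, haO, hG, hp⟩ := h a
  obtain ⟨p, hpe, hpπ⟩ := hp a haO
  obtain ⟨U, F, hU, hpU, hF, hFf⟩ := hf p
  refine ⟨O ∩ G ⁻¹' U, F ∘ G, hG.continuousOn.isOpen_inter_preimage hO hU,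
    ⟨haO, by rwa [Set.mem_preimage, ← hpe]⟩,
    hF.comp (hG.mono Set.inter_subset_left) fun x hx => hx.2, ?_⟩
  rintro a' ⟨ha'O, ha'U⟩
  obtain ⟨p', hp'e, hp'π⟩ := hp a' ha'O
  rw [Function.comp_apply, ← hp'e, hFf p' (by rwa [hp'e]), hp'π]

/-- The monomial map `(y_j) ↦ (∏_j y_j ^ (A i j))_i`, which extends the homomorphism `torusMap A`
from the torus to `ℂ^m`. -/
def monomialMap {k m : ℕ} (A : Matrix (Fin k) (Fin m) ℤ) (y : Fin m → ℂ) : Fin k → ℂ :=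
  fun i => ∏ j, y j ^ A i j

theorem monomialMap_torusCoe {k m : ℕ} (A : Matrix (Fin k) (Fin m) ℤ) (ζ : Fin m → Circle) :
    monomialMap A (torusCoe ζ) = torusCoe (torusMap A ζ) := by
  funext i
  have h : ∀ f : Fin m → Circle, ((∏ j, f j : Circle) : ℂ) = ∏ j, (f j : ℂ) := fun f =>
    map_prod Circle.coeHom f Finset.univ
  simp [monomialMap, torusCoe, torusMap, h]

theorem contDiffAt_monomialMap {k m : ℕ} (A : Matrix (Fin k) (Fin m) ℤ) {y : Fin m → ℂ}
    (hy : ∀ j, y j ≠ 0) : ContDiffAt ℝ ∞ (monomialMap A) y := by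
  refine contDiffAt_pi.2 fun i => ?_
  refine contDiffAt_prod fun j _ => ?_
  have hj : ContDiffAt ℝ ∞ (fun y : Fin m → ℂ => y j) y := by fun_prop
  rcases hA : A i j with n | n
  · simpa using hj.pow n
  · simp only [zpow_negSucc]
    exact (hj.pow (n + 1)).inv (pow_ne_zero _ (hy j))

theorem isOpen_forall_ne_zero {m : ℕ} : IsOpen {y : Fin m → ℂ | ∀ j, y j ≠ 0} := by
  simp only [Set.ofPred_forall]
  exact isOpen_iInter_of_finite fun j => isOpen_ne_fun (continuous_apply j) continuous_const

/-! ### Phases -/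

/-- The phase `z / |z|` of a complex number; it is `1` at `z = 0`. -/
def phase (z : ℂ) : Circle := Circle.exp (Complex.arg z)

theorem norm_mul_phase (z : ℂ) : (‖z‖ : ℂ) * phase z = z := by
  rw [phase, Circle.coe_exp, Complex.norm_mul_exp_arg_mul_I]

theorem coe_phase {z : ℂ} (hz : z ≠ 0) : (phase z : ℂ) = z / ‖z‖ := by
  rw [eq_div_iff (by simpa using hz), mul_comm, norm_mul_phase]

theorem phase_zero : phase 0 = 1 := by simp [phase]

theorem phase_eq {z : ℂ} {r : ℝ} (hr : 0 < r) {t : Circle} (h : z = r * t) : phase z = t := by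
  have hr' : (r : ℂ) ≠ 0 := by exact_mod_cast hr.ne'
  apply Circle.ext
  rw [coe_phase (by rw [h]; exact mul_ne_zero hr' (Circle.coe_ne_zero t)), h]
  rw [norm_mul, Circle.norm_coe, mul_one, Complex.norm_real, Real.norm_eq_abs, abs_of_pos hr,
    mul_div_cancel_left₀ _ hr']

theorem continuous_phase_units : Continuous fun c : ℂˣ => phase c := by
  refine continuous_induced_rng.2 ?_
  have : (fun c : ℂˣ => ((phase c : Circle) : ℂ)) = fun c : ℂˣ => (c : ℂ) / (‖(c : ℂ)‖ : ℂ) :=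
    funext fun c => coe_phase c.ne_zero
  change Continuous fun c : ℂˣ => ((phase c : Circle) : ℂ)
  rw [this]
  exact Units.continuous_val.div (Complex.continuous_ofReal.comp Units.continuous_val.norm)
    fun c => by simp

theorem contDiffAt_div_norm {z : ℂ} (hz : z ≠ 0) :
    ContDiffAt ℝ ∞ (fun z : ℂ => z / (‖z‖ : ℂ)) z := by
  have h : ContDiffAt ℝ ∞ (fun z : ℂ => (‖z‖ : ℂ)) z :=
    Complex.ofRealCLM.contDiff.contDiffAt.comp z (contDiffAt_norm ℝ hz)
  simp only [div_eq_mul_inv]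
  exact contDiffAt_id.mul (h.inv (Complex.ofReal_ne_zero.2 (norm_ne_zero_iff.2 hz)))

/-! ### The solution space -/

variable {α : 𝔪 →ₗ[ℝ] ℝ}

theorem mem_NR_iff (x : Fin d → ℝ) : x ∈ NR α ↔ ∀ t : 𝔪, x ⬝ᵥ (t : Fin d → ℝ) = α t := by
  change ∑ i, x i • coordM 𝔪 i = α ↔ _
  rw [LinearMap.ext_iff]
  simp [coordM, dotProduct]

theorem mem_NR_iff_sub {x₀ : Fin d → ℝ} (h₀ : x₀ ∈ NR α) (x : Fin d → ℝ) :
    x ∈ NR α ↔ ∀ t ∈ 𝔪, (x - x₀) ⬝ᵥ t = 0 := by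
  rw [mem_NR_iff] at h₀ ⊢
  simp only [sub_dotProduct, sub_eq_zero, Subtype.forall] at h₀ ⊢
  exact forall₂_congr fun t ht => by rw [h₀ t ht]

theorem NR_nonempty (α : 𝔪 →ₗ[ℝ] ℝ) : (NR α).Nonempty := by
  obtain ⟨a, ha⟩ := α.exists_extend
  refine ⟨fun i => a (Pi.single i 1), (mem_NR_iff _).2 fun t => ?_⟩
  rw [← ha]
  change _ = a (t : Fin d → ℝ)
  conv_rhs => rw [pi_eq_sum_univ' (t : Fin d → ℝ), map_sum]
  refine Finset.sum_congr rfl fun i _ => ?_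
  rw [map_smul, smul_eq_mul, mul_comm]

/-- The affine parametrization `r ↦ x₀ + r Q` of `𝔑_α` in integral coordinates on `𝔫^*`. -/
def paramNR (S : IntegralSplitting 𝔪) (x₀ : Fin d → ℝ) :
    (Fin (Module.finrank ℝ (NLie 𝔪)) → ℝ) →ᵃ[ℝ] (Fin d → ℝ) where
  toFun r := x₀ + Matrix.vecMul r (realMat S.Q)
  linear := (realMat S.Q).vecMulLinear
  map_vadd' p v := by
    simp only [vadd_eq_add, Matrix.vecMulLinear_apply, Matrix.add_vecMul]
    abel

theorem paramNR_apply (S : IntegralSplitting 𝔪) (x₀ : Fin d → ℝ)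
    (r : Fin (Module.finrank ℝ (NLie 𝔪)) → ℝ) :
    paramNR S x₀ r = x₀ + Matrix.vecMul r (realMat S.Q) := rfl

theorem paramNR_mem (S : IntegralSplitting 𝔪) {x₀ : Fin d → ℝ} (h₀ : x₀ ∈ NR α)
    (r : Fin (Module.finrank ℝ (NLie 𝔪)) → ℝ) : paramNR S x₀ r ∈ NR α := by
  rw [mem_NR_iff_sub h₀]
  intro t ht
  rw [paramNR_apply, add_sub_cancel_left, ← Matrix.dotProduct_mulVec, (S.mem_iff t).1 ht,
    dotProduct_zero]

/-- The inverse of `paramNR`. -/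
def coordNR (S : IntegralSplitting 𝔪) (x₀ x : Fin d → ℝ) :
    Fin (Module.finrank ℝ (NLie 𝔪)) → ℝ :=
  Matrix.vecMul (x - x₀) (realMat S.Q')

theorem coordNR_paramNR (S : IntegralSplitting 𝔪) (x₀ : Fin d → ℝ)
    (r : Fin (Module.finrank ℝ (NLie 𝔪)) → ℝ) : coordNR S x₀ (paramNR S x₀ r) = r := by
  rw [coordNR, paramNR_apply, add_sub_cancel_left, Matrix.vecMul_vecMul, ← realMat_mul,
    S.Q_mul_Q', realMat_one, Matrix.vecMul_one]

theorem paramNR_coordNR (S : IntegralSplitting 𝔪) {x₀ x : Fin d → ℝ} (h₀ : x₀ ∈ NR α)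
    (hx : x ∈ NR α) : paramNR S x₀ (coordNR S x₀ x) = x := by
  rw [mem_NR_iff_sub h₀] at hx
  have h1 : Matrix.vecMul (x - x₀) (realMat S.P') = 0 :=
    dotProduct_eq_zero _ fun r => by
      rw [← Matrix.dotProduct_mulVec]
      exact hx _ (S.P'_mulVec_mem r)
  have h2 := congrArg (fun A => Matrix.vecMul (x - x₀) (realMat A)) S.add_eq_one
  simp only [realMat_one, Matrix.vecMul_one] at h2
  rw [realMat, Matrix.map_add _ Int.cast_add, Matrix.vecMul_add, ← realMat, ← realMat,
    realMat_mul, realMat_mul, ← Matrix.vecMul_vecMul, ← Matrix.vecMul_vecMul, h1,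
    Matrix.zero_vecMul, zero_add] at h2
  rw [paramNR_apply, coordNR, h2, add_sub_cancel]

theorem continuous_coordNR (S : IntegralSplitting 𝔪) (x₀ : Fin d → ℝ) :
    Continuous (coordNR S x₀) :=
  (continuous_id.sub continuous_const).matrix_vecMul continuous_const

theorem contDiff_coordNR (S : IntegralSplitting 𝔪) (x₀ : Fin d → ℝ) :
    ContDiff ℝ ∞ (coordNR S x₀) := by
  unfold coordNR Matrix.vecMul dotProduct
  fun_prop

theorem contDiff_paramNR (S : IntegralSplitting 𝔪) (x₀ : Fin d → ℝ) :
    ContDiff ℝ ∞ (paramNR S x₀) := by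
  simp only [funext (paramNR_apply S x₀)]
  unfold Matrix.vecMul dotProduct
  fun_prop

/-- `𝔑_α` is a translate of `𝔫^*`, and `H_l` is the hyperplane in it with normal `u_l`. -/
theorem NR_eq_translate {x₀ : Fin d → ℝ} (h₀ : x₀ ∈ NR α) (x : Fin d → ℝ) :
    x ∈ NR α ↔ ∃! ξ : Module.Dual ℝ (NLie 𝔪), ∀ i, x i = x₀ i + ξ (u 𝔪 i) := by
  have key : ∀ ξ : Module.Dual ℝ (NLie 𝔪), (∀ i, x i = x₀ i + ξ (u 𝔪 i)) ↔
      ∀ t, ξ (𝔪.mkQ t) = (x - x₀) ⬝ᵥ t := by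
    intro ξ
    constructor
    · intro h t
      have ht : t = ∑ i, t i • Pi.single i (1 : ℝ) := by
        funext j
        simp [Finset.sum_apply, Pi.single_apply]
      conv_lhs => rw [ht, map_sum, map_sum]
      refine Finset.sum_congr rfl fun i _ => ?_
      rw [map_smul, map_smul, Pi.sub_apply, h i, smul_eq_mul, mul_comm, add_sub_cancel_left]
      rfl
    · intro h i
      rw [u, h]
      simp
  simp only [key, mem_NR_iff_sub h₀]
  constructor
  · intro h
    refine ⟨𝔪.liftQ (dotProductBilin ℝ ℝ (x - x₀)) h, fun t => rfl, fun ξ hξ => ?_⟩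
    refine LinearMap.ext fun v => ?_
    obtain ⟨t, rfl⟩ := 𝔪.mkQ_surjective v
    exact hξ t
  · rintro ⟨ξ, hξ, -⟩ t ht
    rw [← hξ t, Submodule.mkQ_apply, (Submodule.Quotient.mk_eq_zero 𝔪).2 ht, map_zero]

/-- The homeomorphism `(ℂ^*)^n ≅ 𝔑_α × N`, through polar coordinates on `ℂ^*`. -/
def kappa (S : IntegralSplitting 𝔪) {x₀ : Fin d → ℝ} (h₀ : x₀ ∈ NR α) :
    (Fin (Module.finrank ℝ (NLie 𝔪)) → ℂˣ) ≃ₜ NR α × NTorus 𝔪 where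
  toFun c := (⟨paramNR S x₀ fun j => Real.log ‖(c j : ℂ)‖, paramNR_mem S h₀ _⟩,
    S.quotientEquiv.symm fun j => phase (c j))
  invFun q j := Units.mk0 ((Real.exp (coordNR S x₀ q.1 j) : ℂ) * (S.quotientEquiv q.2 j : ℂ))
    (mul_ne_zero (by exact_mod_cast (Real.exp_pos _).ne') (Circle.coe_ne_zero _))
  left_inv c := by
    funext j
    apply Units.ext
    simp only [Units.val_mk0, coordNR_paramNR, ContinuousMulEquiv.apply_symm_apply]
    rw [Real.exp_log (by simp), norm_mul_phase]
  right_inv q := by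
    obtain ⟨x, g⟩ := q
    refine Prod.ext (Subtype.ext ?_) ?_
    · simp only [Units.val_mk0, norm_mul, Circle.norm_coe, mul_one, Complex.norm_real,
        Real.norm_eq_abs, Real.abs_exp, Real.log_exp]
      exact paramNR_coordNR S h₀ x.2
    · simp only [Units.val_mk0, phase_eq (Real.exp_pos _) rfl]
      exact S.quotientEquiv.symm_apply_apply g
  continuous_toFun := by
    refine Continuous.prodMk (Continuous.subtype_mk ?_ _) ?_
    · refine (contDiff_paramNR S x₀).continuous.comp (continuous_pi fun j => ?_)
      exact Continuous.log ((Units.continuous_val.comp (continuous_apply j)).norm) (by simp)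
    · exact S.quotientEquiv.symm.continuous.comp
        (continuous_pi fun j => continuous_phase_units.comp (continuous_apply j))
  continuous_invFun := by
    refine continuous_pi fun j => Units.isEmbedding_val₀.continuous_iff.2 ?_
    refine Continuous.mul (Complex.continuous_ofReal.comp (Real.continuous_exp.comp
      ((continuous_apply j).comp ((continuous_coordNR S x₀).comp
        (continuous_subtype_val.comp continuous_fst))))) ?_
    exact continuous_subtype_val.comp ((continuous_apply j).comp
      (S.quotientEquiv.continuous.comp continuous_snd))

theorem smoothAlong_kappa_iff (S : IntegralSplitting 𝔪) {x₀ : Fin d → ℝ} (h₀ : x₀ ∈ NR α)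
    (f : NR α × NTorus 𝔪 → ℝ) :
    SmoothAlong (fun (c : Fin (Module.finrank ℝ (NLie 𝔪)) → ℂˣ) j => (c j : ℂ)) (kappa S h₀) f ↔
    SmoothAlong (fun q : NR α × (Fin d → Circle) => ((q.1 : Fin d → ℝ), torusCoe q.2))
      (fun q => (q.1, (QuotientGroup.mk q.2 : NTorus 𝔪))) f := by
  constructor
  · intro hf
    refine hf.transfer fun a => ⟨Prod.snd ⁻¹' {y | ∀ j, y j ≠ 0},
      fun q j => (Real.exp (coordNR S x₀ q.1 j) : ℂ) * monomialMap S.Q q.2 j,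
      isOpen_forall_ne_zero.preimage continuous_snd, fun j => Circle.coe_ne_zero _, ?_, ?_⟩
    · intro q hq
      refine ContDiffAt.contDiffWithinAt (contDiffAt_pi.2 fun j => ContDiffAt.mul ?_ ?_)
      · have h1 : ContDiff ℝ ∞ fun q : (Fin d → ℝ) × (Fin d → ℂ) => coordNR S x₀ q.1 :=
          (contDiff_coordNR S x₀).comp contDiff_fst
        exact (Complex.ofRealCLM.contDiff.comp
          (Real.contDiff_exp.comp (contDiff_pi.1 h1 j))).contDiffAt
      · exact contDiffAt_pi.1 ((contDiffAt_monomialMap S.Q hq).comp q contDiffAt_snd) j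
    · intro q _
      refine ⟨(kappa S h₀).symm (q.1, QuotientGroup.mk q.2), ?_,
        (kappa S h₀).apply_symm_apply _⟩
      funext j
      simp only [monomialMap_torusCoe]
      rfl
  · intro hf
    refine hf.transfer fun a => ⟨{y | ∀ j, y j ≠ 0},
      fun c => (paramNR S x₀ fun j => Real.log ‖c j‖, monomialMap S.Q' fun j => c j / ‖c j‖),
      isOpen_forall_ne_zero, fun j => (a j).ne_zero, ?_, ?_⟩
    · intro c hc
      have hcj : ∀ j, ContDiffAt ℝ ∞ (fun c : Fin (Module.finrank ℝ (NLie 𝔪)) → ℂ => c j) c :=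
        fun j => by fun_prop
      refine ContDiffAt.contDiffWithinAt (ContDiffAt.prodMk ?_ ?_)
      · refine (contDiff_paramNR S x₀).contDiffAt.comp c (contDiffAt_pi.2 fun j => ?_)
        exact ((hcj j).norm ℝ (hc j)).log (by simpa using hc j)
      · refine (contDiffAt_monomialMap S.Q' fun j => ?_).comp c (contDiffAt_pi.2 fun j => ?_)
        · exact div_ne_zero (hc j) (by simpa using hc j)
        · exact (contDiffAt_div_norm (hc j)).comp c (hcj j)
    · intro c _
      refine ⟨((kappa S h₀ c).1, torusMap S.Q' fun j => phase (c j)), ?_, rfl⟩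
      refine Prod.ext rfl ?_
      simp only [← monomialMap_torusCoe]
      congr 1
      funext j
      exact coe_phase (c j).ne_zero

/-! ### The section of the moment maps -/

/-- The coordinate `z ≥ 0` of the point of `ℍ` with `½(|z|² - |w|²) = x` and `z w = b`. -/
def sectionZ (b : ℂ) (x : ℝ) : ℝ := √(√(x ^ 2 + ‖b‖ ^ 2) + x)

/-- The coordinate `w` of the point of `ℍ` with `½(|z|² - |w|²) = x`, `z w = b` and `z ≥ 0`
(and `w ≥ 0` if `b = 0`). -/
def sectionW (b : ℂ) (x : ℝ) : ℂ := phase b * (√(√(x ^ 2 + ‖b‖ ^ 2) - x) : ℝ)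

theorem abs_le_radius (b : ℂ) (x : ℝ) : |x| ≤ √(x ^ 2 + ‖b‖ ^ 2) :=
  Real.abs_le_sqrt (le_add_of_nonneg_right (sq_nonneg _))

theorem sectionZ_sq (b : ℂ) (x : ℝ) : sectionZ b x ^ 2 = √(x ^ 2 + ‖b‖ ^ 2) + x :=
  Real.sq_sqrt (by linarith [neg_abs_le x, abs_le_radius b x])

theorem norm_sectionW (b : ℂ) (x : ℝ) : ‖sectionW b x‖ = √(√(x ^ 2 + ‖b‖ ^ 2) - x) := by
  rw [sectionW, norm_mul, Circle.norm_coe, one_mul, Complex.norm_real,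
    Real.norm_of_nonneg (Real.sqrt_nonneg _)]

theorem norm_sectionW_sq (b : ℂ) (x : ℝ) : ‖sectionW b x‖ ^ 2 = √(x ^ 2 + ‖b‖ ^ 2) - x := by
  rw [norm_sectionW]
  exact Real.sq_sqrt (by linarith [le_abs_self x, abs_le_radius b x])

theorem sectionZ_mul_sectionW (b : ℂ) (x : ℝ) : (sectionZ b x : ℂ) * sectionW b x = b := by
  have h : sectionZ b x * √(√(x ^ 2 + ‖b‖ ^ 2) - x) = ‖b‖ := by
    rw [sectionZ, ← Real.sqrt_mul (by linarith [neg_abs_le x, abs_le_radius b x]),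
      ← Real.sqrt_sq (norm_nonneg b)]
    congr 1
    have := Real.sq_sqrt (show 0 ≤ x ^ 2 + ‖b‖ ^ 2 by positivity)
    rw [Real.sqrt_sq (norm_nonneg b)]
    linarith
  rw [sectionW, mul_left_comm, ← Complex.ofReal_mul, h, mul_comm, norm_mul_phase]

theorem sectionZ_zero : sectionZ 0 0 = 0 := by simp [sectionZ]

theorem sectionW_zero : sectionW 0 0 = 0 := by simp [sectionW]

theorem continuous_sectionZ (b : ℂ) : Continuous (sectionZ b) := by
  unfold sectionZ
  fun_prop

theorem continuous_sectionW (b : ℂ) : Continuous (sectionW b) := by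
  unfold sectionW
  fun_prop

theorem contDiffAt_radius {b : ℂ} {x : ℝ} (h : b ≠ 0 ∨ x ≠ 0) :
    ContDiffAt ℝ ∞ (fun x : ℝ => √(x ^ 2 + ‖b‖ ^ 2)) x := by
  refine ContDiffAt.sqrt (by fun_prop) (ne_of_gt ?_)
  rcases h with h | h <;> positivity

/-- Although `x ↦ √(|x| + x)` is not smooth at `0`, it is smooth elsewhere, being `0` on the
negative half-line. -/
theorem contDiffAt_sqrt_radius_add {b : ℂ} {x : ℝ} (h : b ≠ 0 ∨ x ≠ 0) :
    ContDiffAt ℝ ∞ (fun x : ℝ => √(√(x ^ 2 + ‖b‖ ^ 2) + x)) x := by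
  by_cases hpos : √(x ^ 2 + ‖b‖ ^ 2) + x ≠ 0
  · exact ((contDiffAt_radius h).add contDiffAt_id).sqrt hpos
  · rw [not_not] at hpos
    have h1 : √(x ^ 2 + ‖b‖ ^ 2) = -x := by linarith
    have h2 := Real.sq_sqrt (show 0 ≤ x ^ 2 + ‖b‖ ^ 2 by positivity)
    rw [h1] at h2
    have hb : b = 0 := by
      rw [← norm_eq_zero, ← sq_eq_zero_iff]
      linarith
    have hx : x < 0 := by
      refine lt_of_le_of_ne ?_ (h.resolve_left (not_not.2 hb))
      linarith [Real.sqrt_nonneg (x ^ 2 + ‖b‖ ^ 2)]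
    refine (contDiffAt_const (c := (0 : ℝ))).congr_of_eventuallyEq ?_
    filter_upwards [gt_mem_nhds hx] with y hy
    rw [hb, norm_zero, zero_pow two_ne_zero, add_zero, Real.sqrt_sq_eq_abs, abs_of_neg hy,
      neg_add_cancel, Real.sqrt_zero]

theorem contDiffAt_sectionZ {b : ℂ} {x : ℝ} (h : b ≠ 0 ∨ x ≠ 0) :
    ContDiffAt ℝ ∞ (sectionZ b) x :=
  contDiffAt_sqrt_radius_add h

theorem contDiffAt_sectionW {b : ℂ} {x : ℝ} (h : b ≠ 0 ∨ x ≠ 0) :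
    ContDiffAt ℝ ∞ (sectionW b) x := by
  have h' : b ≠ 0 ∨ -x ≠ 0 := h.imp_right neg_ne_zero.2
  have h1 : ContDiffAt ℝ ∞ (fun x : ℝ => √(√(x ^ 2 + ‖b‖ ^ 2) - x)) x := by
    simpa [Function.comp_def, sub_eq_add_neg] using
      (contDiffAt_sqrt_radius_add h').comp x contDiffAt_id.neg
  exact contDiffAt_const.mul (Complex.ofRealCLM.contDiff.contDiffAt.comp x h1)

/-- The point `(z, w)` of `ℍ^d` over `x ∈ ℝ^d` and `b ∈ ℂ^d` with all `z_i ≥ 0`. -/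
def sectionPt (b : Fin d → ℂ) (x : Fin d → ℝ) : HSpace d :=
  (fun i => (sectionZ (b i) (x i) : ℂ), fun i => sectionW (b i) (x i))

theorem realCoord_sectionPt (b : Fin d → ℂ) (x : Fin d → ℝ) :
    realCoord (sectionPt b x) = x := by
  funext i
  simp only [realCoord, sectionPt, norm_sectionW_sq, Complex.norm_real, Real.norm_eq_abs,
    sq_abs, sectionZ_sq]
  ring

theorem complexCoord_sectionPt (b : Fin d → ℂ) (x : Fin d → ℝ) :
    complexCoord (sectionPt b x) = b :=
  funext fun i => sectionZ_mul_sectionW (b i) (x i)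

theorem continuous_sectionPt (b : Fin d → ℂ) : Continuous (sectionPt b) := by
  refine Continuous.prodMk (continuous_pi fun i => ?_) (continuous_pi fun i => ?_)
  · exact Complex.continuous_ofReal.comp ((continuous_sectionZ _).comp (continuous_apply i))
  · exact (continuous_sectionW _).comp (continuous_apply i)

/-- The torus element which rotates the section to the point `(z, w)`: the phase of `z_i`, and the
inverse phase of `w_i` if `z_i = 0`. -/
def phaseVec (p : HSpace d) : Fin d → Circle :=
  fun i => if p.1 i = 0 then (phase (p.2 i))⁻¹ else phase (p.1 i)

/-- The section at the moment values of `(z, w)` has coordinates of absolute values `|z|` and `|w|`,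
because `√(x² + |b|²) = ½(|z|² + |w|²)` for `x = ½(|z|² - |w|²)` and `b = z w`. -/
theorem section_norm_eq (z w : ℂ) :
    sectionZ (z * w) ((1 / 2) * (‖z‖ ^ 2 - ‖w‖ ^ 2)) = ‖z‖ ∧
    √(√(((1 / 2) * (‖z‖ ^ 2 - ‖w‖ ^ 2)) ^ 2 + ‖z * w‖ ^ 2) -
      (1 / 2) * (‖z‖ ^ 2 - ‖w‖ ^ 2)) = ‖w‖ := by
  have h : √(((1 / 2) * (‖z‖ ^ 2 - ‖w‖ ^ 2)) ^ 2 + ‖z * w‖ ^ 2) =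
      (1 / 2) * (‖z‖ ^ 2 + ‖w‖ ^ 2) := by
    rw [← Real.sqrt_sq (show 0 ≤ (1 / 2) * (‖z‖ ^ 2 + ‖w‖ ^ 2) by positivity), norm_mul]
    congr 1
    ring
  constructor
  · rw [sectionZ, h, ← Real.sqrt_sq (norm_nonneg z)]
    congr 1
    rw [Real.sqrt_sq (norm_nonneg z)]
    ring
  · rw [h, ← Real.sqrt_sq (norm_nonneg w)]
    congr 1
    rw [Real.sqrt_sq (norm_nonneg w)]
    ring

/-- The torus acts transitively on the points with given moment values. -/
theorem act_phaseVec (p : HSpace d) :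
    act (phaseVec p) (sectionPt (complexCoord p) (realCoord p)) = p := by
  obtain ⟨z, w⟩ := p
  refine Prod.ext (funext fun i => ?_) (funext fun i => ?_)
  · change ((sectionZ (z i * w i) ((1 / 2) * (‖z i‖ ^ 2 - ‖w i‖ ^ 2)) : ℝ) : ℂ) *
      (phaseVec (z, w) i : ℂ) = z i
    rw [(section_norm_eq _ _).1]
    by_cases hz : z i = 0
    · simp [hz]
    · simp only [phaseVec, hz, if_false, norm_mul_phase]
  · change sectionW (z i * w i) ((1 / 2) * (‖z i‖ ^ 2 - ‖w i‖ ^ 2)) *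
      ((phaseVec (z, w) i)⁻¹ : Circle) = w i
    rw [sectionW, (section_norm_eq _ _).2]
    by_cases hz : z i = 0
    · simp only [phaseVec, hz, if_true, zero_mul, phase_zero, Circle.coe_one, one_mul, inv_inv,
        norm_mul_phase]
    · -- For `z, w ≠ 0`, the phase of `z w` is the product of the phases.
      by_cases hw : w i = 0
      · simp [hw]
      · simp only [phaseVec, hz, if_false, Circle.coe_inv, coe_phase hz,
          coe_phase (mul_ne_zero hz hw), norm_mul, Complex.ofReal_mul]
        have hz' : (‖z i‖ : ℂ) ≠ 0 := by simpa using hz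
        have hw' : (‖w i‖ : ℂ) ≠ 0 := by simpa using hw
        field_simp

/-- Two torus elements rotate the section over `x` and `b` to the same point if and only if they
agree in all coordinates in which `x` or `b` is nonzero. -/
theorem act_sectionPt_eq_iff (b : Fin d → ℂ) (x : Fin d → ℝ) (ζ η : Fin d → Circle) :
    act ζ (sectionPt b x) = act η (sectionPt b x) ↔
      ∀ i, ¬ (b i = 0 ∧ x i = 0) → ζ i = η i := by
  constructor
  · intro h i hi
    have hz : (sectionZ (b i) (x i) : ℂ) * (ζ i : ℂ) = sectionZ (b i) (x i) * (η i : ℂ) :=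
      congrFun (congrArg Prod.fst h) i
    have hw : sectionW (b i) (x i) * ((ζ i)⁻¹ : Circle) =
        sectionW (b i) (x i) * ((η i)⁻¹ : Circle) :=
      congrFun (congrArg Prod.snd h) i
    rcases mul_eq_mul_left_iff.1 hz with hz | hz
    · exact Circle.ext hz
    rcases mul_eq_mul_left_iff.1 hw with hw | hw
    · exact inv_injective (Circle.ext hw)
    refine absurd ⟨?_, ?_⟩ hi
    · rw [← sectionZ_mul_sectionW (b i) (x i), hz, zero_mul]
    · have h1 := sectionZ_sq (b i) (x i)
      have h2 := norm_sectionW_sq (b i) (x i)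
      rw [Complex.ofReal_eq_zero.1 hz] at h1
      rw [hw, norm_zero] at h2
      linarith
  · intro h
    refine Prod.ext (funext fun i => ?_) (funext fun i => ?_)
    all_goals
      by_cases hi : b i = 0 ∧ x i = 0
      · simp [act, sectionPt, hi.1, hi.2, sectionZ_zero, sectionW_zero]
      · simp [act, h i hi]

variable {β : 𝔪 →ₗ[ℝ] ℂ}

/-! ### The collapsing relation -/

/-- The preimage of `torusOf 𝔪 J` in `T^d` is the product of `M` and the coordinate subtorus
of `J`. -/
theorem mem_torusOf_mk_iff (J : Set (Fin d)) (κ : Fin d → Circle) :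
    (QuotientGroup.mk κ : NTorus 𝔪) ∈ torusOf 𝔪 J ↔
      ∃ t : Fin d → ℝ, (∀ i, i ∉ J → t i = 0) ∧ (expT t)⁻¹ * κ ∈ subtorus 𝔪 := by
  have hspan : ∀ v : NLie 𝔪, v ∈ Submodule.span ℝ (u 𝔪 '' J) ↔
      ∃ t : Fin d → ℝ, (∀ i, i ∉ J → t i = 0) ∧ 𝔪.mkQ t = v := by
    intro v
    constructor
    · intro hv
      induction hv using Submodule.span_induction with
      | mem v hv =>
        obtain ⟨l, hl, rfl⟩ := hv
        exact ⟨Pi.single l 1, fun i hi => Pi.single_eq_of_ne (ne_of_mem_of_not_mem hl hi).symm _, rfl⟩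
      | zero => exact ⟨0, fun _ _ => rfl, map_zero _⟩
      | add v w _ _ hv hw =>
        obtain ⟨s, hs, rfl⟩ := hv
        obtain ⟨t, ht, rfl⟩ := hw
        exact ⟨s + t, fun i hi => by simp [hs i hi, ht i hi], map_add _ _ _⟩
      | smul a v _ hv =>
        obtain ⟨s, hs, rfl⟩ := hv
        exact ⟨a • s, fun i hi => by simp [hs i hi], map_smul _ _ _⟩
    · rintro ⟨t, ht, rfl⟩
      rw [pi_eq_sum_univ' t, map_sum]
      refine Submodule.sum_mem _ fun i _ => ?_
      rw [map_smul]
      by_cases hi : i ∈ J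
      · refine Submodule.smul_mem _ _ (Submodule.subset_span ⟨i, hi, ?_⟩)
        rfl
      · rw [ht i hi, zero_smul]
        exact Submodule.zero_mem _
  constructor
  · rintro ⟨v, hv, h⟩
    obtain ⟨t, ht, rfl⟩ := (hspan v).1 hv
    exact ⟨t, ht, QuotientGroup.eq.1 h⟩
  · rintro ⟨t, ht, h⟩
    exact ⟨𝔪.mkQ t, (hspan _).2 ⟨t, ht, rfl⟩, QuotientGroup.eq.2 h⟩

theorem collapseMk_eq_iff (b : NC β) (x x' : NR α) (g g' : NTorus 𝔪) :
    collapseMk b (x, g) = collapseMk b (x', g') ↔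
      x = x' ∧ g⁻¹ * g' ∈ torusOf 𝔪 (active b x) := by
  have hrel : collapseMk b (x, g) = collapseMk b (x', g') ↔
      Relation.EqvGen (CollapseStep α b) (x, g) (x', g') := Quotient.eq
  rw [hrel]
  constructor
  · suffices ∀ p q : NR α × NTorus 𝔪, Relation.EqvGen (CollapseStep α b) p q →
        p.1 = q.1 ∧ p.2⁻¹ * q.2 ∈ torusOf 𝔪 (active b p.1) from this _ _
    intro p q h
    induction h with
    | rel p q h =>
      obtain ⟨l, hb, hx, h1, c, hc, h2⟩ := h
      refine ⟨h1.symm, ?_⟩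
      rw [h2, inv_mul_cancel_left, torusOf_eq_iSup]
      exact le_iSup₂ (f := fun l (_ : l ∈ active b p.1) => circleOf 𝔪 l) l ⟨hb, hx⟩ hc
    | refl p => exact ⟨rfl, by rw [inv_mul_cancel]; exact one_mem _⟩
    | symm p q _ ih =>
      refine ⟨ih.1.symm, ?_⟩
      rw [← ih.1]
      simpa using inv_mem ih.2
    | trans p q r _ _ ih ih' =>
      refine ⟨ih.1.trans ih'.1, ?_⟩
      rw [← ih.1] at ih'
      simpa [mul_assoc] using mul_mem ih.2 ih'.2
  · rintro ⟨rfl, h⟩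
    -- The translations which stay inside the classes over `x` form a subgroup.
    let K : Subgroup (NTorus 𝔪) :=
      { carrier := {c | ∀ g, Relation.EqvGen (CollapseStep α b) (x, g) (x, g * c)}
        one_mem' := fun g => by
          rw [mul_one]
          exact .refl _
        mul_mem' := fun {c c'} hc hc' g => by
          rw [← mul_assoc]
          exact (hc g).trans _ _ _ (hc' _)
        inv_mem' := fun {c} hc g => by
          simpa using (hc (g * c⁻¹)).symm }
    have hK : torusOf 𝔪 (active b x) ≤ K := by
      rw [torusOf_eq_iSup]
      exact iSup₂_le fun l hl c hc g => .rel _ _ ⟨l, hl.1, hl.2, rfl, c, hc, rfl⟩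
    simpa using hK h g

theorem torusOf_empty : torusOf 𝔪 ∅ = ⊥ := by
  rw [torusOf_eq_iSup]
  simp

theorem collapseMk_eq_iff_of_unique_wall (b : NC β) (i : Fin d) (hi : b ∈ W β i)
    (hj : ∀ j, j ≠ i → b ∉ W β j) (x x' : NR α) (g g' : NTorus 𝔪) :
    collapseMk b (x, g) = collapseMk b (x', g') ↔
      x = x' ∧ (g = g' ∨ (x ∈ H α i ∧ g⁻¹ * g' ∈ circleOf 𝔪 i)) := by
  rw [collapseMk_eq_iff]
  refine and_congr_right fun _ => ?_
  by_cases hx : x ∈ H α i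
  · have h : active b x = {i} := by
      ext l
      constructor
      · intro hl
        by_contra hne
        exact hj l hne hl.1
      · rintro rfl
        exact ⟨hi, hx⟩
    rw [h, ← circleOf_eq_torusOf]
    constructor
    · exact fun h => Or.inr ⟨hx, h⟩
    · rintro (rfl | h)
      · rw [inv_mul_cancel]
        exact one_mem _
      · exact h.2
  · have h : active b x = ∅ := by
      refine Set.eq_empty_of_forall_notMem fun l hl => ?_
      by_cases hli : l = i
      · exact hx (hli ▸ hl.2)
      · exact hj l hli hl.1
    rw [h, torusOf_empty, Subgroup.mem_bot, inv_mul_eq_one]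
    simp [hx]

/-! ### The fiber as a quotient of `𝔑_α × T^d` -/

theorem continuous_realCoord : Continuous (realCoord (d := d)) := by
  unfold realCoord
  fun_prop

theorem contDiff_realCoord : ContDiff ℝ ∞ (realCoord (d := d)) := by
  refine contDiff_pi.2 fun i => contDiff_const.mul (ContDiff.sub ?_ ?_)
  · exact ContDiff.norm_sq ℝ (by fun_prop)
  · exact ContDiff.norm_sq ℝ (by fun_prop)

theorem continuous_complexCoord : Continuous (complexCoord (d := d)) := by
  unfold complexCoord
  fun_prop

theorem continuous_act :
    Continuous fun q : (Fin d → Circle) × HSpace d => act q.1 q.2 := by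
  unfold act
  refine Continuous.prodMk (continuous_pi fun i => ?_) (continuous_pi fun i => ?_)
  · exact ((continuous_apply i).comp (continuous_fst.comp continuous_snd)).mul
      (continuous_subtype_val.comp ((continuous_apply i).comp continuous_fst))
  · exact ((continuous_apply i).comp (continuous_snd.comp continuous_snd)).mul
      (continuous_subtype_val.comp ((continuous_apply i).comp continuous_fst).inv)

theorem act_sectionPt_mem (b : NC β) (x : NR α) (ζ : Fin d → Circle) :
    act ζ (sectionPt b.1 x.1) ∈ levelSet α β := by
  refine act_mem α β ⟨?_, ?_⟩ ζ
  · rw [muR_eq, realCoord_sectionPt]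
    exact x.2
  · rw [muC_eq, complexCoord_sectionPt]
    exact b.2

/-- The map `(x, ζ) ↦ ζ · s(x)` onto the part of the level set over `b`, where `s` is the
section. -/
def rotateSection (α : 𝔪 →ₗ[ℝ] ℝ) (b : NC β) (q : NR α × (Fin d → Circle)) : FiberLevel α b :=
  ⟨⟨act q.2 (sectionPt b.1 q.1.1), act_sectionPt_mem b q.1 q.2⟩, Subtype.ext (by
    change complexCoord (act q.2 (sectionPt b.1 q.1.1)) = b.1
    rw [complexCoord_act, complexCoord_sectionPt])⟩

theorem complexCoord_fiberLevel {b : NC β} (p : FiberLevel α b) :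
    complexCoord (p.1 : HSpace d) = b.1 :=
  congrArg Subtype.val p.2

/-- The point of `𝔑_α × T^d` which parametrizes a given point of the level set over `b`. -/
def polar {b : NC β} (p : FiberLevel α b) : NR α × (Fin d → Circle) :=
  (residualR α β (fiberMk α b p).1, phaseVec (p.1 : HSpace d))

theorem rotateSection_polar {b : NC β} (p : FiberLevel α b) :
    rotateSection α b (polar p) = p := by
  refine Subtype.ext (Subtype.ext ?_)
  change act (phaseVec p.1.1) (sectionPt b.1 (realCoord p.1.1)) = p.1.1
  rw [← complexCoord_fiberLevel p, act_phaseVec]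

theorem residualR_rotateSection (b : NC β) (q : NR α × (Fin d → Circle)) :
    residualR α β (fiberMk α b (rotateSection α b q)).1 = q.1 := Subtype.ext (by
  change realCoord (act q.2 (sectionPt b.1 q.1.1)) = q.1.1
  rw [realCoord_act, realCoord_sectionPt])

theorem continuous_rotateSection (b : NC β) : Continuous (rotateSection α b) := by
  refine Continuous.subtype_mk (Continuous.subtype_mk ?_ _) _
  exact continuous_act.comp (continuous_snd.prodMk
    ((continuous_sectionPt b.1).comp (continuous_subtype_val.comp continuous_fst)))

/-- `rotateSection` is closed because it is proper: the torus is compact, and the moment map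
recovers the component in `𝔑_α`. -/
theorem isQuotientMap_rotateSection (b : NC β) :
    IsQuotientMap (rotateSection α b) := by
  have hcont := continuous_rotateSection (α := α) b
  let m : FiberLevel α b → NR α := fun p => residualR α β (fiberMk α b p).1
  have hm : Continuous m := Continuous.subtype_mk
    (continuous_realCoord.comp (continuous_subtype_val.comp continuous_subtype_val)) _
  have hcomp : m ∘ rotateSection α b = Prod.fst := funext (residualR_rotateSection b)
  have hproper : IsProperMap (rotateSection α b) :=
    isProperMap_of_comp_of_t2 hcont hm (hcomp ▸ isProperMap_fst_of_compactSpace)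
  exact hproper.isClosedMap.isQuotientMap hcont fun p => ⟨polar p, rotateSection_polar p⟩

/-- A quotient map restricts to a quotient map over the closed subset `F_b`. -/
theorem isQuotientMap_fiberMk (b : NC β) : IsQuotientMap (fiberMk α b) := by
  have hY : IsQuotientMap (Quotient.mk (orbitSetoid α β)) := isQuotientMap_quot_mk
  have hclosed : IsClosed {p : levelSet α β | residualC α β (Quotient.mk _ p) = b} := by
    have : Continuous fun p : levelSet α β => residualC α β (Quotient.mk _ p) :=
      Continuous.subtype_mk (continuous_complexCoord.comp continuous_subtype_val) _
    exact isClosed_singleton.preimage this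
  refine isQuotientMap_iff_isClosed.2 ⟨?_, fun s => ⟨fun hs => hs.preimage ?_, fun hs => ?_⟩⟩
  · rintro ⟨y, hy⟩
    obtain ⟨p, rfl⟩ := hY.surjective y
    exact ⟨⟨p, hy⟩, rfl⟩
  · exact (hY.continuous.comp continuous_subtype_val).subtype_mk _
  · -- The preimage of `F_b` is closed in the level set, so that closed sets can be compared in `Y`
    -- and in the level set.
    have h1 : IsClosed (Subtype.val '' (fiberMk α b ⁻¹' s)) :=
      hclosed.isClosedEmbedding_subtypeVal.isClosedMap _ hs
    have h2 : Subtype.val '' (fiberMk α b ⁻¹' s) =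
        Quotient.mk (orbitSetoid α β) ⁻¹' (Subtype.val '' s) := by
      ext p
      constructor
      · rintro ⟨q, hq, rfl⟩
        exact ⟨fiberMk α b q, hq, rfl⟩
      · rintro ⟨⟨y, hy⟩, hys, rfl⟩
        exact ⟨⟨p, hy⟩, hys, rfl⟩
    rw [h2, (isQuotientMap_iff_isClosed.1 hY).2 _ |>.symm] at h1
    have h3 := h1.preimage (continuous_subtype_val (p := fun y : Y α β => residualC α β y = b))
    rwa [Set.preimage_image_eq _ Subtype.val_injective] at h3

theorem fiberMk_eq_iff {b : NC β} (p q : FiberLevel α b) :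
    fiberMk α b p = fiberMk α b q ↔ ∃ ζ ∈ subtorus 𝔪, act ζ (p.1 : HSpace d) = q.1 := by
  rw [Subtype.ext_iff]
  exact Quotient.eq (r := orbitSetoid α β)

/-- The points of `𝔑_α × T^d` over one point of the fiber are those which are identified by the
collapsing: the stabilizer of `s(x)` in `T^d` is the coordinate subtorus of the active indices. -/
theorem fiberMk_rotateSection_eq_iff (b : NC β) (q q' : NR α × (Fin d → Circle)) :
    fiberMk α b (rotateSection α b q) = fiberMk α b (rotateSection α b q') ↔
      collapseMk b (q.1, (QuotientGroup.mk q.2 : NTorus 𝔪)) =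
        collapseMk b (q'.1, (QuotientGroup.mk q'.2 : NTorus 𝔪)) := by
  obtain ⟨x, ζ⟩ := q
  obtain ⟨x', ζ'⟩ := q'
  rw [collapseMk_eq_iff, fiberMk_eq_iff, ← QuotientGroup.mk_inv, ← QuotientGroup.mk_mul,
    mem_torusOf_mk_iff]
  change (∃ η ∈ subtorus 𝔪, act η (act ζ (sectionPt b.1 x.1)) =
    act ζ' (sectionPt b.1 x'.1)) ↔ _
  constructor
  · rintro ⟨η, hη, h⟩
    have hx : x = x' := Subtype.ext (by
      simpa only [realCoord_act, realCoord_sectionPt] using congrArg realCoord h)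
    subst hx
    rw [← act_mul, act_sectionPt_eq_iff] at h
    refine ⟨rfl, fun i => Complex.arg ((((η * ζ)⁻¹ * ζ') i : Circle) : ℂ), fun i hi => ?_, ?_⟩
    · simp [← h i hi]
    · have : expT (fun i => Complex.arg ((((η * ζ)⁻¹ * ζ') i : Circle) : ℂ)) =
          (η * ζ)⁻¹ * ζ' := funext fun i => Circle.exp_arg _
      rw [this]
      convert hη using 1
      rw [mul_inv, inv_inv, mul_mul_mul_comm, mul_comm ζ'⁻¹ ζ', mul_assoc η ζ]
      simp
  · rintro ⟨rfl, t, ht, h⟩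
    refine ⟨_, h, ?_⟩
    rw [← act_mul, act_sectionPt_eq_iff]
    intro i hi
    simp [expT, ht i hi]

/-- Two quotients of a space by the same relation are homeomorphic. -/
theorem exists_homeomorph_of_isQuotientMap {A X Z : Type*} [TopologicalSpace A]
    [TopologicalSpace X] [TopologicalSpace Z] {f : A → X} {g : A → Z} (hf : IsQuotientMap f)
    (hg : IsQuotientMap g) (h : ∀ a a', g a = g a' ↔ f a = f a') :
    ∃ e : X ≃ₜ Z, ∀ a, e (f a) = g a := by
  have h1 : ∀ a, g (Function.surjInv hf.surjective (f a)) = g a := fun a =>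
    (h _ _).2 (Function.surjInv_eq _ _)
  have h2 : ∀ a, f (Function.surjInv hg.surjective (g a)) = f a := fun a =>
    (h _ _).1 (Function.surjInv_eq _ _)
  refine ⟨{ toFun := fun x => g (Function.surjInv hf.surjective x)
            invFun := fun z => f (Function.surjInv hg.surjective z)
            left_inv := fun x => ?_
            right_inv := fun z => ?_
            continuous_toFun := hf.continuous_iff.2 ?_
            continuous_invFun := hg.continuous_iff.2 ?_ }, h1⟩
  · obtain ⟨a, rfl⟩ := hf.surjective x
    simp only [h1, h2]
  · obtain ⟨a, rfl⟩ := hg.surjective z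
    simp only [h1, h2]
  · exact hg.continuous.congr fun a => (h1 a).symm
  · exact hf.continuous.congr fun a => (h2 a).symm

theorem exists_homeomorph_fiber (α : 𝔪 →ₗ[ℝ] ℝ) (b : NC β) :
    ∃ Φ : Collapse α b ≃ₜ Fiber α b, ∀ q : NR α × (Fin d → Circle),
      Φ (collapseMk b (q.1, (QuotientGroup.mk q.2 : NTorus 𝔪))) =
        fiberMk α b (rotateSection α b q) := by
  have h1 : IsQuotientMap fun q : NR α × (Fin d → Circle) =>
      collapseMk b (q.1, (QuotientGroup.mk q.2 : NTorus 𝔪)) := by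
    have h2 : IsQuotientMap (collapseMk (α := α) b) := isQuotientMap_quot_mk
    have h3 : IsOpenQuotientMap (QuotientGroup.mk : (Fin d → Circle) → NTorus 𝔪) :=
      QuotientGroup.isOpenQuotientMap_mk
    exact h2.comp ((IsOpenQuotientMap.id (X := NR α)).prodMap h3).isQuotientMap
  exact exists_homeomorph_of_isQuotientMap h1
    ((isQuotientMap_fiberMk b).comp (isQuotientMap_rotateSection b))
    fun q q' => fiberMk_rotateSection_eq_iff b q q'

/-! ### Smoothness on the strata -/

/-- On a stratum, the coordinates in `J` of the section vanish; with these replaced by `0`, the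
section extends smoothly to a neighbourhood of the stratum in `ℝ^d`. -/
theorem smoothAlong_model_of_fiber (b : NC β) (J : Set (Fin d)) (f : Fiber α b → ℝ)
    (hf : SmoothAlong (fun p : FiberStratum α b J => (p.1.1 : HSpace d))
      (fun p => fiberMk α b p.1) f) :
    SmoothAlong (fun q : ModelStratum α b J => ((q.1.1 : Fin d → ℝ), torusCoe q.1.2))
      (fun q => fiberMk α b (rotateSection α b q.1)) f := by
  classical
  refine hf.transfer fun a => ⟨{y | (∀ i, i ∉ J → b.1 i ≠ 0 ∨ y.1 i ≠ 0) ∧ ∀ i, y.2 i ≠ 0},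
    fun y => (fun i => if i ∈ J then 0 else (sectionZ (b.1 i) (y.1 i) : ℂ) * y.2 i,
      fun i => if i ∈ J then 0 else sectionW (b.1 i) (y.1 i) * (y.2 i)⁻¹), ?_, ?_, ?_, ?_⟩
  · have h : IsOpen {y : (Fin d → ℝ) × (Fin d → ℂ) | ∀ i, i ∉ J → b.1 i ≠ 0 ∨ y.1 i ≠ 0} := by
      simp only [Set.ofPred_forall]
      refine isOpen_iInter_of_finite fun i => isOpen_iInter_of_finite fun _ => ?_
      refine isOpen_const.union (isOpen_ne_fun ?_ continuous_const)
      fun_prop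
    exact h.inter (isOpen_forall_ne_zero.preimage continuous_snd)
  · refine ⟨fun i hi => ?_, fun i => Circle.coe_ne_zero _⟩
    rw [← a.2] at hi
    exact not_and_or.1 hi
  · rintro y ⟨hy, hy'⟩
    have hy1 : ∀ i, ContDiffAt ℝ ∞ (fun y : (Fin d → ℝ) × (Fin d → ℂ) => y.1 i) y :=
      fun i => by fun_prop
    have hy2 : ∀ i, ContDiffAt ℝ ∞ (fun y : (Fin d → ℝ) × (Fin d → ℂ) => y.2 i) y :=
      fun i => by fun_prop
    refine ContDiffAt.contDiffWithinAt (ContDiffAt.prodMk (contDiffAt_pi.2 fun i => ?_)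
      (contDiffAt_pi.2 fun i => ?_))
    · by_cases hi : i ∈ J
      · simp only [hi, if_true]
        exact contDiffAt_const
      · simp only [hi, if_false]
        exact (Complex.ofRealCLM.contDiff.contDiffAt.comp y
          ((contDiffAt_sectionZ (hy i hi)).comp y (hy1 i))).mul (hy2 i)
    · by_cases hi : i ∈ J
      · simp only [hi, if_true]
        exact contDiffAt_const
      · simp only [hi, if_false]
        exact ((contDiffAt_sectionW (hy i hi)).comp y (hy1 i)).mul ((hy2 i).inv (hy' i))
  · intro q _
    have hJ : ∀ i, i ∈ J → b.1 i = 0 ∧ q.1.1.1 i = 0 := fun i hi => by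
      rw [← q.2] at hi
      exact hi
    refine ⟨⟨rotateSection α b q.1, by rw [residualR_rotateSection]; exact q.2⟩, ?_, rfl⟩
    change act q.1.2 (sectionPt b.1 q.1.1.1) = _
    refine Prod.ext (funext fun i => ?_) (funext fun i => ?_)
    all_goals
      by_cases hi : i ∈ J
      · simp [hi, act, sectionPt, (hJ i hi).1, (hJ i hi).2, sectionZ_zero, sectionW_zero]
      · simp [hi, act, sectionPt, torusCoe]

/-- Near a point of a stratum, the phases of the coordinates not in `J` depend smoothly on the point
of the level set. -/
theorem smoothAlong_fiber_of_model (b : NC β) (J : Set (Fin d)) (f : Fiber α b → ℝ)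
    (hf : SmoothAlong (fun q : ModelStratum α b J => ((q.1.1 : Fin d → ℝ), torusCoe q.1.2))
      (fun q => fiberMk α b (rotateSection α b q.1)) f) :
    SmoothAlong (fun p : FiberStratum α b J => (p.1.1 : HSpace d))
      (fun p => fiberMk α b p.1) f := by
  classical
  refine hf.transfer fun a => ?_
  obtain ⟨z, hz⟩ : ∃ z, z = (a.1.1 : HSpace d).1 := ⟨_, rfl⟩
  refine ⟨{p | ∀ i, i ∉ J → if z i = 0 then p.2 i ≠ 0 else p.1 i ≠ 0},
    fun p => (realCoord p, fun i => if i ∈ J then 1 else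
      if z i = 0 then (p.2 i / ‖p.2 i‖)⁻¹ else p.1 i / ‖p.1 i‖), ?_, ?_, ?_, ?_⟩
  · simp only [Set.ofPred_forall]
    refine isOpen_iInter_of_finite fun i => isOpen_iInter_of_finite fun _ => ?_
    split_ifs
    · exact isOpen_ne_fun (by fun_prop) continuous_const
    · exact isOpen_ne_fun (by fun_prop) continuous_const
  · intro i hi
    split_ifs with h
    · rw [hz] at h
      intro hw
      rw [← a.2] at hi
      refine hi ⟨?_, ?_⟩
      · change b.1 i = 0
        rw [← complexCoord_fiberLevel a.1, complexCoord, h, zero_mul]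
      · change realCoord a.1.1.1 i = 0
        simp [realCoord, h, hw]
    · rwa [← hz]
  · intro p hp
    refine ContDiffAt.contDiffWithinAt (contDiff_realCoord.contDiffAt.prodMk
      (contDiffAt_pi.2 fun i => ?_))
    have hp1 : ContDiffAt ℝ ∞ (fun p : HSpace d => p.1 i) p := by fun_prop
    have hp2 : ContDiffAt ℝ ∞ (fun p : HSpace d => p.2 i) p := by fun_prop
    by_cases hi : i ∈ J
    · simp only [hi, if_true]
      exact contDiffAt_const
    · have hpi := hp i hi
      by_cases h : z i = 0
      · simp only [hi, h, if_true, if_false] at hpi ⊢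
        have h0 : p.2 i / (‖p.2 i‖ : ℂ) ≠ 0 :=
          div_ne_zero hpi (Complex.ofReal_ne_zero.2 (norm_ne_zero_iff.2 hpi))
        exact (ContDiffAt.comp p (contDiffAt_div_norm hpi) hp2).inv h0
      · simp only [hi, h, if_false] at hpi ⊢
        exact (contDiffAt_div_norm hpi).comp p hp1
  · intro p hp
    refine ⟨⟨polar p.1, p.2⟩, ?_, by rw [rotateSection_polar]⟩
    refine Prod.ext rfl (funext fun i => ?_)
    change (phaseVec p.1.1.1 i : ℂ) = _
    have hprod : ∀ p : FiberStratum α b J, p.1.1.1.1 i * p.1.1.1.2 i = b.1 i := fun p =>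
      congrFun (complexCoord_fiberLevel p.1) i
    by_cases hi : i ∈ J
    · simp only [hi, if_true]
      have hpi := hi
      rw [← p.2] at hpi
      have hb : p.1.1.1.1 i * p.1.1.1.2 i = 0 := (hprod p).trans hpi.1
      have hx : (1 / 2) * (‖p.1.1.1.1 i‖ ^ 2 - ‖p.1.1.1.2 i‖ ^ 2) = 0 := hpi.2
      have hz0 : p.1.1.1.1 i = 0 := by
        rcases mul_eq_zero.1 hb with h | h
        · exact h
        · simpa [h] using hx
      have hw0 : p.1.1.1.2 i = 0 := by simpa [hz0] using hx
      simp [phaseVec, hz0, hw0, phase_zero]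
    · have hpi := hp i hi
      by_cases h : z i = 0
      · simp only [hi, h, if_true, if_false] at hpi ⊢
        have hz0 : p.1.1.1.1 i = 0 := by
          have hb := (hprod p).trans (hprod a).symm
          rw [← hz, h, zero_mul] at hb
          exact (mul_eq_zero.1 hb).resolve_right hpi
        simp only [phaseVec, hz0, if_true, Circle.coe_inv, coe_phase hpi]
      · simp only [hi, h, if_false] at hpi ⊢
        simp only [phaseVec, hpi, if_false, coe_phase hpi]

end ToricHK

end

theorem theorem4p4 {d : ℕ} (𝔪 : Submodule ℝ (Fin d → ℝ)) (h𝔪 : IsRational 𝔪)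
    (α : 𝔪 →ₗ[ℝ] ℝ) (β : 𝔪 →ₗ[ℝ] ℂ) (b : NC β) :
    -- the space `𝔑_α × N` is `ℝ^n × T^n ≅ (ℂ^*)^n`, where `n = dim 𝔫`
    (∃ (A : (Fin (Module.finrank ℝ (NLie 𝔪)) → ℝ) →ᵃ[ℝ] (Fin d → ℝ))
        (φ : (Fin (Module.finrank ℝ (NLie 𝔪)) → Circle) ≃ₜ* NTorus 𝔪)
        (κ : (Fin (Module.finrank ℝ (NLie 𝔪)) → ℂˣ) ≃ₜ NR α × NTorus 𝔪),
      Function.Injective A ∧ Set.range A = NR α ∧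
      (∀ c r t, (∀ j, (c j : ℂ) = (Real.exp (r j) : ℂ) * (t j : ℂ)) →
        ((κ c).1 : Fin d → ℝ) = A r ∧ (κ c).2 = φ t) ∧
      ∀ f : NR α × NTorus 𝔪 → ℝ,
        SmoothAlong (fun (c : Fin (Module.finrank ℝ (NLie 𝔪)) → ℂˣ) j => (c j : ℂ)) κ f ↔
        SmoothAlong (fun q : NR α × (Fin d → Circle) => ((q.1 : Fin d → ℝ), torusCoe q.2))
          (fun q => (q.1, (QuotientGroup.mk q.2 : NTorus 𝔪))) f) ∧
    -- `𝔑_α` is a translate of `𝔫^*`, and `H_l` is the hyperplane in it with normal `u_l`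
    (∃ x₀ ∈ NR α,
      (∀ x, x ∈ NR α ↔ ∃! ξ : Module.Dual ℝ (NLie 𝔪), ∀ i, x i = x₀ i + ξ (u 𝔪 i)) ∧
      ∀ (l : Fin d) (x : NR α) (ξ : Module.Dual ℝ (NLie 𝔪)),
        (∀ i, x.1 i = x₀ i + ξ (u 𝔪 i)) → (x ∈ H α l ↔ ξ (u 𝔪 l) = -x₀ l)) ∧
    -- `F_b` is the collapsed space: a homeomorphism over `𝔑_α`, equivariant under `N`, which is a
    -- diffeomorphism on every stratum
    (∃ Φ : Collapse α b ≃ₜ Fiber α b,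
      (∀ (x : NR α) (g : NTorus 𝔪), residualR α β (Φ (collapseMk b (x, g))).1 = x) ∧
      (∀ (x : NR α) (g h : NTorus 𝔪),
        (Φ (collapseMk b (x, g * h))).1 = actY α β g (Φ (collapseMk b (x, h))).1) ∧
      ∀ (J : Set (Fin d)) (f : Fiber α b → ℝ),
        SmoothAlong (fun p : FiberStratum α b J => (p.1.1 : HSpace d))
          (fun p => fiberMk α b p.1) f ↔
        SmoothAlong (fun q : ModelStratum α b J => ((q.1.1 : Fin d → ℝ), torusCoe q.1.2))
          (fun q => Φ (collapseMk b (q.1.1, (QuotientGroup.mk q.1.2 : NTorus 𝔪)))) f) ∧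
    -- `b` generic on a single wall: precisely the circle of `u_i` is collapsed, precisely over `H_i`
    (∀ i, b ∈ W β i → (∀ j, j ≠ i → b ∉ W β j) →
      (u 𝔪 i ≠ 0 → Nonempty (circleOf 𝔪 i ≃ₜ* Circle)) ∧
      ∀ (x x' : NR α) (g g' : NTorus 𝔪),
        collapseMk b (x, g) = collapseMk b (x', g') ↔
          x = x' ∧ (g = g' ∨ (x ∈ H α i ∧ g⁻¹ * g' ∈ circleOf 𝔪 i))) ∧
    -- over an intersection of several `H_l`, the subtorus spanned by their `u_l` is collapsed
    (∀ (x x' : NR α) (g g' : NTorus 𝔪),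
      collapseMk b (x, g) = collapseMk b (x', g') ↔
        x = x' ∧ g⁻¹ * g' ∈ torusOf 𝔪 (active b x)) ∧
    ∀ J : Set (Fin d),
      torusOf 𝔪 J = (⨆ l ∈ J, circleOf 𝔪 l) ∧
      Nonempty (torusOf 𝔪 J ≃ₜ*
        (Fin (Module.finrank ℝ (Submodule.span ℝ (u 𝔪 '' J))) → Circle)) := by
  obtain ⟨S⟩ := exists_integralSplitting h𝔪
  obtain ⟨x₀, h₀⟩ := NR_nonempty α
  refine ⟨⟨paramNR S x₀, S.quotientEquiv.symm, kappa S h₀, ?_, ?_, ?_, smoothAlong_kappa_iff S h₀⟩,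
    ⟨x₀, h₀, NR_eq_translate h₀, fun l x ξ h => ?_⟩, ?_,
    fun i hi hj => ⟨circleOf_equiv h𝔪 i, collapseMk_eq_iff_of_unique_wall b i hi hj⟩,
    collapseMk_eq_iff b, fun J => ⟨torusOf_eq_iSup J, torusOf_equiv h𝔪 J⟩⟩
  · exact Function.LeftInverse.injective (coordNR_paramNR S x₀)
  · refine Set.Subset.antisymm ?_ fun x hx => ⟨_, paramNR_coordNR S h₀ hx⟩
    rintro _ ⟨r, rfl⟩
    exact paramNR_mem S h₀ r
  · intro c r t h
    refine ⟨congrArg (paramNR S x₀) (funext fun j => ?_),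
      congrArg S.quotientEquiv.symm (funext fun j => phase_eq (Real.exp_pos (r j)) (h j))⟩
    rw [h j, norm_mul, Circle.norm_coe, mul_one, Complex.norm_real, Real.norm_eq_abs,
      Real.abs_exp, Real.log_exp]
  · change x.1 l = 0 ↔ _
    rw [h l, add_comm, add_eq_zero_iff_eq_neg]
  · obtain ⟨Φ, hΦ⟩ := exists_homeomorph_fiber α b
    refine ⟨Φ, fun x g => ?_, fun x g h => ?_, fun J f => ?_⟩
    · obtain ⟨ζ, rfl⟩ := QuotientGroup.mk_surjective g
      rw [hΦ (x, ζ)]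
      exact residualR_rotateSection b (x, ζ)
    · obtain ⟨ζ, rfl⟩ := QuotientGroup.mk_surjective g
      obtain ⟨η, rfl⟩ := QuotientGroup.mk_surjective h
      rw [← QuotientGroup.mk_mul, hΦ (x, ζ * η), hΦ (x, η)]
      exact congrArg (Quotient.mk (orbitSetoid α β)) (Subtype.ext (act_mul ζ η _))
    · simp only [fun q : ModelStratum α b J => hΦ q.1]
      exact ⟨smoothAlong_model_of_fiber b J f, smoothAlong_fiber_of_model b J f⟩
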